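/- Let $\Bbbk$ be an algebraically closed field, $n\ge 0$, and let $Q$ be a quiver whose underlying graph is the Dynkin diagram $1 - 2 - \cdots - (n+2)$ of type $\mathbb{A}_{n+2}$. Let $\operatorname{rep} Q$ be the category of finite dimensional representations of $Q$ over $\Bbbk$, and for $1\le i\le j\le n+2$ let $M(i,j)$ be the representation with space $\Bbbk$ at each vertex $\ell$ with $i\le \ell\le j$ and $0$ at the others, with the identity map on each arrow between two vertices of $\{i,\dots,j\}$ and $0$ on the other arrows. Let $P(Q)$ be a convex $(n+3)$-gon in the plane (no vertex lies in the convex hull of the others) with vertices $0,1,\dots,n+2$ ordered strictly from left to right, such that $0$ and $n+2$ lie on a horizontal line $L$ and, for $1\le i\le n+1$, the vertex $i$ lies strictly above $L$ if $Q$ has the arrow $i\to i+1$ and strictly below $L$ if $Q$ has the arrow $i\leftarrow i+1$. For $0\le i<j\le n+2$ let $\gamma(i,j)$ be the line segment between the vertices $i$ and $j$ (a diagonal or a boundary edge), and put $F(\gamma(i,j))=M(i+1,j)$. Two distinct line segments cross if their relative interiors intersect. A triangulation of $P(Q)$ (boundary edges included) is a maximal set of pairwise noncrossing line segments $\gamma(i,j)$.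 A representation $T\in\operatorname{rep}Q$ is almost rigid if it is basic (no indecomposable representation occurs twice as a direct summand) and, for all indecomposable summands $A,B$ of $T$ (including $A\cong B$), either $\operatorname{Ext}^1(A,B)=0$, or $\operatorname{Ext}^1(A,B)$ is one-dimensional and generated by the class of a short exact sequence $0\to B\to E\to A\to 0$ with $E$ indecomposable. It is maximal almost rigid if it is almost rigid and $T\oplus M$ is not almost rigid for every nonzero $M\in\operatorname{rep} Q$. Let $\operatorname{mar}(Q)$ be the set of isomorphism classes of maximal almost rigid representations of $Q$. **Theorem.** The map sending a triangulation $\mathcal{T}$ to the isomorphism class of $\bigoplus_{\gamma\in\mathcal{T}}F(\gamma)$ is a bijection $$F\colon\{\text{triangulations of } P(Q)\}\longrightarrow \operatorname{mar}(Q).$$ Moreover, for any two distinct line segments $\gamma,\delta$, the representation $F(\gamma)\oplus F(\delta)$ is almost rigid if and only if $\gamma$ and $\delta$ do not cross. -/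

import Mathlib

open CategoryTheory CategoryTheory.Limits

universe u

noncomputable section

namespace AlmostRigid

/-! ### The quiver and its representations

An orientation of the Dynkin diagram `1 — 2 — ⋯ — n+2` is a map `ε : Fin (n + 1) → Bool`.
The quiver vertex labelled `ℓ` is the element `ℓ - 1` of `Fin (n + 2)`, and `i : Fin (n + 1)` stands
for the edge between the vertices labelled `i + 1` and `i + 2`. -/

/-- The vertices of the quiver of type `𝔸_{n+2}` with orientation `ε`. -/
def Vertex {n : ℕ} (_ε : Fin (n + 1) → Bool) : Type := Fin (n + 2)

/-- The arrows: the edge `i` is oriented to the right if `ε i = true`, to the left otherwise. -/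
inductive Arrow {n : ℕ} (ε : Fin (n + 1) → Bool) : Fin (n + 2) → Fin (n + 2) → Type
  | right (i : Fin (n + 1)) (h : ε i = true) : Arrow ε i.castSucc i.succ
  | left (i : Fin (n + 1)) (h : ε i = false) : Arrow ε i.succ i.castSucc

instance {n : ℕ} (ε : Fin (n + 1) → Bool) : Quiver.{0} (Vertex ε) where
  Hom a b := Arrow ε a b

/-- The category `rep Q` of finite dimensional representations over `k`. -/
abbrev RepQ (k : Type u) [Field k] {n : ℕ} (ε : Fin (n + 1) → Bool) : Type (u + 1) :=
  Paths (Vertex ε) ⥤ FGModuleCat.{u} k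

instance (k : Type u) [Field k] {n : ℕ} (ε : Fin (n + 1) → Bool) :
    HasExt.{u + 1} (RepQ k ε) :=
  HasExt.standard _

instance (k : Type u) [Field k] {n : ℕ} (ε : Fin (n + 1) → Bool) :
    HasFiniteBiproducts (RepQ k ε) :=
  Abelian.hasFiniteBiproducts

/-! ### Almost rigid representations -/

section

variable {k : Type u} [Field k] {n : ℕ} {ε : Fin (n + 1) → Bool}

/-- `A` is an indecomposable direct summand of `T`. -/
def IsIndecSummand (A T : RepQ k ε) : Prop :=
  Indecomposable A ∧ ∃ Z : RepQ k ε, Nonempty (T ≅ A ⊞ Z)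

/-- `T` is basic: it has no repeated (indecomposable) direct summand. -/
def IsBasic (T : RepQ k ε) : Prop :=
  ∀ A : RepQ k ε, Indecomposable A → ¬ ∃ Z : RepQ k ε, Nonempty (T ≅ (A ⊞ A) ⊞ Z)

/-- `Ext¹(A, B)` is one-dimensional, generated by the class of a short exact sequence
`0 ⟶ B ⟶ E ⟶ A ⟶ 0` with indecomposable middle term. -/
def ExtGeneratedByIndec (A B : RepQ k ε) : Prop :=
  Module.finrank k (Abelian.Ext A B 1) = 1 ∧
    ∃ (E : RepQ k ε) (f : B ⟶ E) (g : E ⟶ A) (w : f ≫ g = 0)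
      (hS : (ShortComplex.mk f g w).ShortExact),
      Submodule.span k {(hS.extClass : Abelian.Ext A B 1)} = ⊤ ∧ Indecomposable E

/-- Almost rigid representations. -/
def IsAlmostRigid (T : RepQ k ε) : Prop :=
  IsBasic T ∧ ∀ A B : RepQ k ε, IsIndecSummand A T → IsIndecSummand B T →
    Subsingleton (Abelian.Ext A B 1) ∨ ExtGeneratedByIndec A B

/-- Maximal almost rigid representations: no nonzero summand can be added. -/
def IsMaximalAlmostRigid (T : RepQ k ε) : Prop :=
  IsAlmostRigid T ∧ ∀ M : RepQ k ε, ¬ IsZero M → ¬ IsAlmostRigid (T ⊞ M)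

end

/-- The set `mar(Q)` of isomorphism classes of maximal almost rigid representations. -/
def mar (k : Type u) [Field k] {n : ℕ} (ε : Fin (n + 1) → Bool) :
    Set (Quotient (isIsomorphicSetoid (RepQ k ε))) :=
  {x | ∃ T : RepQ k ε, IsMaximalAlmostRigid T ∧ Quotient.mk _ T = x}

/-! ### The polygon, its line segments and its triangulations -/

/-- `p` draws the polygon `P(Q)` as a convex polygon in the plane: the vertices `0, …, n+2` appear
in order from left to right, `0` and `n+2` lie on a horizontal line, and the vertex `i + 1`
(with `i : Fin (n + 1)`) lies above that line if the edge `i` points to the right, and below it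
otherwise. -/
structure IsPolygon {n : ℕ} (ε : Fin (n + 1) → Bool) (p : Fin (n + 3) → ℝ × ℝ) : Prop where
  left_to_right : StrictMono fun i => (p i).1
  horizontal : (p 0).2 = (p (Fin.last (n + 2))).2
  upper : ∀ i : Fin (n + 1), ε i = true → (p 0).2 < (p i.succ.castSucc).2
  lower : ∀ i : Fin (n + 1), ε i = false → (p i.succ.castSucc).2 < (p 0).2
  convex : ConvexIndependent ℝ p

/-- The line segments `γ(i, j)`, `0 ≤ i < j ≤ n+2`: all diagonals and boundary edges. -/
@[ext]
structure LineSegment (n : ℕ) where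
  i : Fin (n + 3)
  j : Fin (n + 3)
  lt : i < j

/-- The endpoints determine a line segment. -/
theorem LineSegment.injective (n : ℕ) :
    Function.Injective fun γ : LineSegment n => (γ.i, γ.j) := by
  intro a b h
  simp only [Prod.mk.injEq] at h
  exact LineSegment.ext h.1 h.2

instance (n : ℕ) : Finite (LineSegment n) := Finite.of_injective _ (LineSegment.injective n)

/-- Two line segments cross: they are distinct and their relative interiors meet. -/
def Cross {n : ℕ} (p : Fin (n + 3) → ℝ × ℝ) (γ δ : LineSegment n) : Prop :=
  γ ≠ δ ∧ (openSegment ℝ (p γ.i) (p γ.j) ∩ openSegment ℝ (p δ.i) (p δ.j)).Nonempty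

/-- A triangulation (boundary edges included): a maximal set of pairwise noncrossing
line segments. -/
def IsTriangulation {n : ℕ} (p : Fin (n + 3) → ℝ × ℝ) (T : Set (LineSegment n)) : Prop :=
  Maximal (fun S : Set (LineSegment n) => ∀ γ ∈ S, ∀ δ ∈ S, ¬ Cross p γ δ) T

/-! ### The map `F` -/

/-- The linear map `k^a → k^b` between spaces of dimension at most one (`a`, `b` propositions):
the identity of `k` if `a` and `b` hold, and zero otherwise. -/
def indicatorMap (k : Type u) [Field k] (a b : Prop) :
    (PLift a → k) →ₗ[k] (PLift b → k) :=
  open scoped Classical in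
  LinearMap.pi fun _ => if h : a then LinearMap.proj ⟨h⟩ else 0

/-- The interval representation with space `k` at the vertices `v : Fin (n + 2)`
with `a ≤ v < b` and zero elsewhere, and identity maps inside the interval. Since `v` carries
the label `v + 1`, this is `M(a + 1, b)`. -/
def interval (k : Type u) [Field k] {n : ℕ} (ε : Fin (n + 1) → Bool) (a b : ℕ) : RepQ k ε :=
  Paths.lift
    { obj := fun v : Vertex ε =>
        FGModuleCat.of k (PLift (a ≤ Fin.val (n := n + 2) v ∧ Fin.val (n := n + 2) v < b) → k)
      map := fun {_ _} _ => FGModuleCat.ofHom (indicatorMap k _ _) }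

/-- `F(γ(i, j)) = M(i + 1, j)`. -/
def F (k : Type u) [Field k] {n : ℕ} (ε : Fin (n + 1) → Bool) (γ : LineSegment n) : RepQ k ε :=
  interval k ε γ.i γ.j

/-- `F` on sets of line segments: the isomorphism class of `⨁ F(γ)`. -/
def FSet (k : Type u) [Field k] {n : ℕ} (ε : Fin (n + 1) → Bool) (T : Set (LineSegment n)) :
    Quotient (isIsomorphicSetoid (RepQ k ε)) :=
  Quotient.mk _ (⨁ fun γ : T => F k ε γ.1)

end AlmostRigid

end

/-! The proof turns both sides into combinatorics of intervals. On the algebraic side, every nonzero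
representation has an interval representation as a retract (`exists_retract_interval`), and
intervals are bricks. Hence the indecomposables are exactly the F(γ), and a basic representation is
the same thing as a set of segments (`IsBasic.exists_iso_biproduct_F`, `isBasic_biproduct_F`,
`isRetract_F_biproduct_iff`). Only pairs of segments then remain to be compared.

As the quiver has no relations, Ext¹(A, B) vanishes iff every family of maps indexed by the arrows
is a coboundary. For intervals, solving this equation means integrating a scalar function along the
common support, subject to vanishing conditions at its two ends. The outcome depends only on the
orientation there (`subsingleton_ext_interval_iff`, `HasExtension`).

On the geometric side, the difference of the heights of two segments is affine in the abscissa, and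
convexity determines its signs at the ends of the common range. Crossing is a change of sign, which
gives the criterion `CombCross` (`cross_iff_combCross`).

The two criteria are linked as follows. If two segments cross, one of the two Ext¹ is nonzero and
the supports share a vertex, so a middle term has dimension at least 2 there and is not an interval.
If they do not cross, a nonzero Ext¹ arises only for adjacent intervals; it is then a line,
generated by the sequence whose middle term is the union interval. Thus almost rigid means pairwise
noncrossing, and maximality agrees on both sides. -/

noncomputable section

namespace AlmostRigid

/-! ### Classes in Ext¹ and splitting of short exact sequences. -/

section Yoneda

open DerivedCategory Pretriangulated

universe w v

variable {C : Type u} [Category.{v} C] [Abelian C]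

/-- A short complex whose image in the derived category extends to a distinguished triangle
is short exact. -/
theorem shortExact_of_distinguished_single [HasDerivedCategory.{w} C] (S : ShortComplex C)
    (h : (singleFunctor C 0).obj S.X₃ ⟶ ((singleFunctor C 0).obj S.X₁)⟦(1 : ℤ)⟧)
    (hT : Triangle.mk ((singleFunctor C 0).map S.f) ((singleFunctor C 0).map S.g) h ∈
      distTriang (DerivedCategory C)) : S.ShortExact := by
  -- Both connecting maps around degree 0 vanish, since a complex in degree 0 has no homology in
  -- degrees -1 and 1.
  have h₁ : HomologySequence.δ (Triangle.mk ((singleFunctor C 0).map S.f)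
      ((singleFunctor C 0).map S.g) h) (-1) 0 = 0 :=
    (isZero_of_isGE ((singleFunctor C 0).obj S.X₃) 0 (-1) (by lia)).eq_of_src _ _
  have h₂ : HomologySequence.δ (Triangle.mk ((singleFunctor C 0).map S.f)
      ((singleFunctor C 0).map S.g) h) 0 1 = 0 :=
    (isZero_of_isLE ((singleFunctor C 0).obj S.X₁) 0 1 (by lia)).eq_of_tgt _ _
  have hm := (HomologySequence.mono_homologyMap_mor₁_iff _ hT (-1) 0).2 h₁
  have he := (HomologySequence.epi_homologyMap_mor₂_iff _ hT 0 1).2 h₂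
  let S' : ShortComplex C := S.map (singleFunctor C 0 ⋙ homologyFunctor C 0)
  have hmap : S'.ShortExact :=
    { exact := HomologySequence.exact₂ _ hT 0
      mono_f := hm
      epi_g := he }
  exact (ShortComplex.shortExact_iff_of_iso
    (S.mapNatIso (singleFunctorCompHomologyFunctorIso C 0))).1 hmap

/-- Every class in `Ext¹(A, B)` is killed by the deflation of a short exact sequence
`0 ⟶ B ⟶ E ⟶ A ⟶ 0`. -/
theorem exists_shortExact_mk₀_comp_eq_zero [HasExt.{w} C] {A B : C} (x : Abelian.Ext A B 1) :
    ∃ (E : C) (f : B ⟶ E) (g : E ⟶ A) (w : f ≫ g = 0),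
      (ShortComplex.mk f g w).ShortExact ∧
        (Abelian.Ext.mk₀ g).comp x (zero_add 1) = 0 := by
  let := HasDerivedCategory.standard C
  -- The class is read as a map A ⟶ B[1] and completed to a triangle B ⟶ Y ⟶ A ⟶ B[1]. The ends lie
  -- in the heart, hence so does Y, which therefore comes from an object E.
  obtain ⟨Y, f, g, hT⟩ := distinguished_cocone_triangle₂
    (show (singleFunctor C 0).obj A ⟶ ((singleFunctor C 0).obj B)⟦(1 : ℤ)⟧ from x.hom)
  have := TStructure.t.isLE₂ _ hT 0 (inferInstanceAs (IsLE ((singleFunctor C 0).obj B) 0))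
    (inferInstanceAs (IsLE ((singleFunctor C 0).obj A) 0))
  have := TStructure.t.isGE₂ _ hT 0 (inferInstanceAs (IsGE ((singleFunctor C 0).obj B) 0))
    (inferInstanceAs (IsGE ((singleFunctor C 0).obj A) 0))
  change IsLE Y 0 at *
  change IsGE Y 0 at *
  obtain ⟨E, ⟨e⟩⟩ := exists_iso_singleFunctor_obj_of_isGE_of_isLE Y 0
  obtain ⟨f', hf'⟩ := (singleFunctor C 0).map_surjective (f ≫ e.hom)
  obtain ⟨g', hg'⟩ := (singleFunctor C 0).map_surjective (e.inv ≫ g)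
  have w₀ : f ≫ g = 0 := comp_distTriang_mor_zero₁₂ _ hT
  have w₁ : g ≫ x.hom = 0 := comp_distTriang_mor_zero₂₃ _ hT
  have w : f' ≫ g' = 0 := (singleFunctor C 0).map_injective (by
    rw [Functor.map_comp, hf', hg', Functor.map_zero]; simp [w₀])
  refine ⟨E, f', g', w, shortExact_of_distinguished_single _ x.hom
    (isomorphic_distinguished _ hT _ (Triangle.isoMk _ _ (Iso.refl _) e.symm (Iso.refl _) ?_ ?_ ?_)),
    ?_⟩
  · change (singleFunctor C 0).map f' ≫ e.inv = 𝟙 ((singleFunctor C 0).obj B) ≫ f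
    simp [hf']
  · change (singleFunctor C 0).map g' ≫ 𝟙 ((singleFunctor C 0).obj A) = e.inv ≫ g
    simp [hg']
  · change x.hom ≫ (shiftFunctor (DerivedCategory C) (1 : ℤ)).map
      (𝟙 ((singleFunctor C 0).obj B)) = 𝟙 ((singleFunctor C 0).obj A) ≫ x.hom
    rw [Category.id_comp, CategoryTheory.Functor.map_id]
    exact Category.comp_id _
  · ext
    simp [hg', w₁, ShiftedHom.mk₀_comp]

/-- If all short exact sequences `0 ⟶ B ⟶ E ⟶ A ⟶ 0` split, then `Ext¹(A, B) = 0`. -/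
theorem subsingleton_ext_one_of_split [HasExt.{w} C] {A B : C}
    (h : ∀ (E : C) (f : B ⟶ E) (g : E ⟶ A) (w : f ≫ g = 0),
      (ShortComplex.mk f g w).ShortExact → ∃ s : A ⟶ E, s ≫ g = 𝟙 A) :
    Subsingleton (Abelian.Ext A B 1) := by
  refine subsingleton_of_forall_eq 0 fun x => ?_
  obtain ⟨E, f, g, w, hS, hx⟩ := exists_shortExact_mk₀_comp_eq_zero x
  obtain ⟨s, hs⟩ := h E f g w hS
  rw [← Abelian.Ext.mk₀_id_comp x, ← hs, ← Abelian.Ext.mk₀_comp_mk₀,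
    Abelian.Ext.comp_assoc_of_second_deg_zero, hx, Abelian.Ext.comp_zero]

/-- A short exact sequence with trivial class splits. -/
theorem exists_section_of_extClass_eq_zero [HasExt.{w} C] {S : ShortComplex C}
    (hS : S.ShortExact) (h : hS.extClass = 0) : ∃ s : S.X₃ ⟶ S.X₂, s ≫ S.g = 𝟙 S.X₃ := by
  obtain ⟨x, hx⟩ := Abelian.Ext.covariant_sequence_exact₃ S.X₃ hS (Abelian.Ext.mk₀ (𝟙 S.X₃))
    (zero_add 1) (by rw [h, Abelian.Ext.comp_zero])
  obtain ⟨s, rfl⟩ := (Abelian.Ext.mk₀_bijective _ _).2 x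
  exact ⟨s, (Abelian.Ext.mk₀_bijective _ _).1 (by simpa using hx)⟩

end Yoneda

/-! ### Representations as families of linear maps; Ext¹ by cocycles and coboundaries. -/

section Representations

variable {k : Type u} [Field k] {n : ℕ} {ε : Fin (n + 1) → Bool}

/-- A vertex of the quiver as an object of its path category. -/
def pathVertex (ε : Fin (n + 1) → Bool) (v : Fin (n + 2)) : Paths (Vertex ε) := v

/-- The vector space of a representation at a vertex. -/
abbrev space (M : RepQ k ε) (v : Fin (n + 2)) : Type u :=
  (M.obj (pathVertex ε v)).carrier

instance (M : RepQ k ε) (v : Fin (n + 2)) : Module.Finite k (space M v) :=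
  (M.obj (pathVertex ε v)).property

/-- The linear map of a representation along an arrow. -/
def arrowMap (M : RepQ k ε) {a b : Fin (n + 2)} (α : Arrow ε a b) : space M a →ₗ[k] space M b :=
  (M.map (Quiver.Hom.toPath (V := Vertex ε) (a := a) (b := b) α)).hom.hom

/-- The component of a morphism of representations at a vertex. -/
def component {M N : RepQ k ε} (φ : M ⟶ N) (v : Fin (n + 2)) : space M v →ₗ[k] space N v :=
  (φ.app (pathVertex ε v)).hom.hom

theorem component_naturality {M N : RepQ k ε} (φ : M ⟶ N) {a b : Fin (n + 2)} (α : Arrow ε a b)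
    (x : space M a) : component φ b (arrowMap M α x) = arrowMap N α (component φ a x) := by
  have h := φ.naturality (Quiver.Hom.toPath (V := Vertex ε) (a := a) (b := b) α)
  exact LinearMap.congr_fun (congrArg (fun f => f.hom.hom) h) x

theorem hom_ext {M N : RepQ k ε} {φ ψ : M ⟶ N}
    (h : ∀ v x, component φ v x = component ψ v x) : φ = ψ := by
  apply NatTrans.ext
  funext v
  exact FGModuleCat.hom_ext (LinearMap.ext (h v))

@[simp] theorem component_id (M : RepQ k ε) (v : Fin (n + 2)) :
    component (𝟙 M) v = LinearMap.id := rfl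

@[simp] theorem component_comp {M N L : RepQ k ε} (φ : M ⟶ N) (ψ : N ⟶ L) (v : Fin (n + 2)) :
    component (φ ≫ ψ) v = component ψ v ∘ₗ component φ v := rfl

@[simp] theorem component_zero (M N : RepQ k ε) (v : Fin (n + 2)) :
    component (0 : M ⟶ N) v = 0 := rfl

@[simp] theorem component_smul {M N : RepQ k ε} (c : k) (φ : M ⟶ N) (v : Fin (n + 2)) :
    component (c • φ) v = c • component φ v := rfl

/-- A family of linear maps commuting with the arrows is a morphism of representations. -/
def homMk {M N : RepQ k ε} (h : ∀ v, space M v →ₗ[k] space N v)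
    (comm : ∀ {a b} (α : Arrow ε a b) (x : space M a),
      h b (arrowMap M α x) = arrowMap N α (h a x)) : M ⟶ N where
  app v := ConcreteCategory.ofHom (C := FGModuleCat k) (h v)
  naturality := by
    intro X Y f
    induction f using Paths.induction with
    | id => simp
    | comp p q hp =>
      rename_i b c
      rw [M.map_comp, N.map_comp, Category.assoc]
      have hq : M.map ((Paths.of (Vertex ε)).map q) ≫
          ConcreteCategory.ofHom (C := FGModuleCat k) (h c) =
          ConcreteCategory.ofHom (C := FGModuleCat k) (h b) ≫
            N.map ((Paths.of (Vertex ε)).map q) :=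
        FGModuleCat.hom_ext (LinearMap.ext (comm q))
      exact (congrArg (M.map p ≫ ·) hq).trans ((Category.assoc _ _ _).symm.trans
        ((congrArg (· ≫ N.map ((Paths.of (Vertex ε)).map q)) hp).trans (Category.assoc _ _ _)))

@[simp] theorem component_homMk {M N : RepQ k ε} (h : ∀ v, space M v →ₗ[k] space N v)
    (comm : ∀ {a b} (α : Arrow ε a b) (x : space M a),
      h b (arrowMap M α x) = arrowMap N α (h a x)) (v : Fin (n + 2)) :
    component (homMk h comm) v = h v := rfl

/-- The representation with given spaces and linear maps. -/
def repMk (V : Fin (n + 2) → FGModuleCat.{u} k)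
    (f : ∀ {a b}, Arrow ε a b → (V a).carrier →ₗ[k] (V b).carrier) : RepQ k ε :=
  Paths.lift
    { obj := fun v : Vertex ε => V v
      map := fun {_ _} α => ConcreteCategory.ofHom (C := FGModuleCat k) (f α) }

/-! ### Short exact sequences -/

theorem component_injective_of_mono {M N : RepQ k ε} (f : M ⟶ N) [Mono f] (v : Fin (n + 2)) :
    Function.Injective (component f v) := by
  have : Mono (f.app (pathVertex ε v)) := (NatTrans.mono_iff_mono_app f).1 inferInstance _
  have := (ModuleCat.mono_iff_injective
    ((forget₂ (FGModuleCat k) (ModuleCat k)).map (f.app (pathVertex ε v)))).1 inferInstance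
  exact this

theorem component_surjective_of_epi {M N : RepQ k ε} (f : M ⟶ N) [Epi f] (v : Fin (n + 2)) :
    Function.Surjective (component f v) := by
  have : Epi (f.app (pathVertex ε v)) := (NatTrans.epi_iff_epi_app f).1 inferInstance _
  have := (ModuleCat.epi_iff_surjective
    ((forget₂ (FGModuleCat k) (ModuleCat k)).map (f.app (pathVertex ε v)))).1 inferInstance
  exact this

theorem exists_component_eq_of_exact {S : ShortComplex (RepQ k ε)} (hS : S.ShortExact)
    (v : Fin (n + 2)) (y : space S.X₂ v) (hy : component S.g v y = 0) :
    ∃ x, component S.f v x = y := by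
  have h₁ := hS.map_of_exact ((evaluation _ _).obj (pathVertex ε v))
  have h₂ := h₁.map_of_exact (forget₂ (FGModuleCat k) (ModuleCat k))
  exact (ShortComplex.moduleCat_exact_iff _).1 h₂.exact y hy

theorem component_comp_apply_eq_zero {M N L : RepQ k ε} {f : M ⟶ N} {g : N ⟶ L} (w : f ≫ g = 0)
    (v : Fin (n + 2)) (x : space M v) : component g v (component f v x) = 0 := by
  rw [← LinearMap.comp_apply, ← component_comp, w]; rfl

/-- Exactness may be tested at each vertex: injectivity of f makes the vertexwise lifts unique,
hence linear and compatible with the arrows, so f is a kernel of g. -/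
theorem shortExact_mk {M N L : RepQ k ε} (f : M ⟶ N) (g : N ⟶ L) (w : f ≫ g = 0)
    (hf : ∀ v, Function.Injective (component f v)) (hg : ∀ v, Function.Surjective (component g v))
    (hfg : ∀ v y, component g v y = 0 → ∃ x, component f v x = y) :
    (ShortComplex.mk f g w).ShortExact := by
  have hm : Mono f := ⟨fun a b h => hom_ext fun v x => hf v (by
    have := congrArg (fun t => component t v x) h
    simpa using this)⟩
  have he : Epi g := by
    refine ⟨fun a b h => hom_ext fun v x => ?_⟩
    obtain ⟨y, rfl⟩ := hg v x
    have := congrArg (fun t => component t v y) h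
    simpa using this
  refine { exact := ?_, mono_f := hm, epi_g := he }
  refine ShortComplex.exact_of_f_is_kernel _ (KernelFork.IsLimit.ofι' f w fun {X} t ht => ?_)
  have hx : ∀ v (x : space X v), ∃ y, component f v y = component t v x := fun v x =>
    hfg v _ (by rw [← LinearMap.comp_apply, ← component_comp, ht]; rfl)
  choose s hs using hx
  refine ⟨homMk (fun v => { toFun := s v, map_add' := fun x y => hf v ?_,
                            map_smul' := fun c x => hf v ?_ }) fun {a b} α x => hf b ?_,
    hom_ext fun v x => ?_⟩
  · simp [hs]
  · simp [hs]
  · change component f b (s b _) = component f b (arrowMap M α (s a x))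
    rw [hs, component_naturality, component_naturality, hs]
  · exact hs v x

/-! ### Vanishing of `Ext¹` -/

/-- `Ext¹(A, B)` vanishes if every cocycle is a coboundary. -/
theorem subsingleton_ext_one_of_coboundary {A B : RepQ k ε}
    (h : ∀ c : (∀ {a b : Fin (n + 2)}, Arrow ε a b → space A a →ₗ[k] space B b),
      ∃ h : ∀ v, space A v →ₗ[k] space B v, ∀ {a b : Fin (n + 2)} (α : Arrow ε a b),
        c α = h b ∘ₗ arrowMap A α - arrowMap B α ∘ₗ h a) :
    Subsingleton (Abelian.Ext A B 1) := by
  refine subsingleton_ext_one_of_split fun E f g w hS => ?_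
  have := hS.mono_f
  have := hS.epi_g
  have hf := component_injective_of_mono f
  -- Vertexwise linear sections always exist. Their failure to commute with the arrows lands in B
  -- and is the cocycle d; writing d as a coboundary of h corrects them to the section σ + f ∘ h.
  have hσ : ∀ v, ∃ σ : space A v →ₗ[k] space E v, component g v ∘ₗ σ = LinearMap.id := fun v =>
    (component g v).exists_rightInverse_of_surjective
      (LinearMap.range_eq_top.2 (component_surjective_of_epi g v))
  choose σ hσ using hσ
  have hσ' : ∀ v x, component g v (σ v x) = x := fun v x => LinearMap.congr_fun (hσ v) x
  have hd : ∀ a b (α : Arrow ε a b) (x : space A a), ∃ y, component f b y =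
      arrowMap E α (σ a x) - σ b (arrowMap A α x) := fun a b α x =>
    exists_component_eq_of_exact hS b _ (by
      change component g b _ = 0
      rw [map_sub, component_naturality, hσ', hσ', sub_self])
  choose d hd using hd
  obtain ⟨h, hh⟩ := h fun {a b} α =>
    { toFun := d a b α
      map_add' := fun x y => hf b (by simp only [map_add, hd]; abel)
      map_smul' := fun c x => hf b (by simp only [map_smul, hd, smul_sub, RingHom.id_apply]) }
  have hh' : ∀ {a b} (α : Arrow ε a b) (x : space A a),
      d a b α x = h b (arrowMap A α x) - arrowMap B α (h a x) := fun α x =>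
    LinearMap.congr_fun (hh α) x
  refine ⟨homMk (fun v => σ v + component f v ∘ₗ h v) fun {a b} α x => ?_, hom_ext fun v x => ?_⟩
  · have := hd a b α x
    rw [hh', map_sub, component_naturality] at this
    simp only [LinearMap.add_apply, LinearMap.comp_apply, map_add]
    rw [sub_eq_sub_iff_add_eq_add] at this
    rw [add_comm, this]
  · simp [hσ', component_comp_apply_eq_zero w]

/-- The extension of `A` by `B` defined by a cocycle. -/
def cocycleExtension {A B : RepQ k ε}
    (c : ∀ {a b : Fin (n + 2)}, Arrow ε a b → space A a →ₗ[k] space B b) : RepQ k ε :=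
  repMk (fun v => FGModuleCat.of k (space B v × space A v)) fun {_ _} α =>
    (LinearMap.coprod (arrowMap B α) (c α)).prod (arrowMap A α ∘ₗ LinearMap.snd k _ _)

/-- If `Ext¹(A, B)` vanishes then every cocycle is a coboundary. -/
theorem coboundary_of_subsingleton_ext_one {A B : RepQ k ε} [Subsingleton (Abelian.Ext A B 1)]
    (c : ∀ {a b : Fin (n + 2)}, Arrow ε a b → space A a →ₗ[k] space B b) :
      ∃ h : ∀ v, space A v →ₗ[k] space B v, ∀ {a b : Fin (n + 2)} (α : Arrow ε a b),
        c α = h b ∘ₗ arrowMap A α - arrowMap B α ∘ₗ h a := by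
  let E := cocycleExtension c
  let f : B ⟶ E := homMk (fun v : Fin (n + 2) => LinearMap.inl k (space B v) (space A v)) fun {a b} α x => by
    change (arrowMap B α x, (0 : space A b)) = (arrowMap B α x + c α 0, arrowMap A α 0)
    simp
  let g : E ⟶ A := homMk (fun v : Fin (n + 2) => LinearMap.snd k (space B v) (space A v)) fun _ _ => rfl
  have hS : (ShortComplex.mk f g (hom_ext fun v x => rfl)).ShortExact :=
    shortExact_mk _ _ _ (fun _ _ _ h => congrArg Prod.fst h) (fun v x => ⟨((0 : space B v), x), rfl⟩)
      fun v y hy => ⟨y.1, Prod.ext rfl (Eq.symm hy)⟩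
  -- The first coordinate of a section of B × A ⟶ A is the required h: naturality of the section is
  -- the coboundary equation.
  obtain ⟨s, hs⟩ := exists_section_of_extClass_eq_zero hS (Subsingleton.elim _ _)
  have hs' : ∀ v x, (show space B v × space A v from component s v x).2 = x := fun v x =>
    congrArg (fun t => component t v x) hs
  refine ⟨fun v => LinearMap.fst k (space B v) (space A v) ∘ₗ component s v, fun {a b} α => ?_⟩
  ext x
  have h₁ : (show space B b × space A b from component s b (arrowMap A α x)).1 =
      arrowMap B α (show space B a × space A a from component s a x).1 +
        c α (show space B a × space A a from component s a x).2 :=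
    congrArg (fun t : space B b × space A b => t.1) (component_naturality s α x)
  rw [hs'] at h₁
  exact eq_sub_of_add_eq' h₁.symm

end Representations

/-! ### Interval representations and vanishing of Ext¹ between them. -/

section Intervals

variable {k : Type u} [Field k] {n : ℕ} {ε : Fin (n + 1) → Bool}

/-- The standard vector of an interval representation at a vertex (zero off the interval). -/
def unitVec (i j : ℕ) (v : Fin (n + 2)) : space (interval k ε i j) v :=
  fun _ : PLift (i ≤ v.val ∧ v.val < j) => (1 : k)

open scoped Classical in
/-- The coordinate of a vector of an interval representation (zero off the interval). -/
def coord (i j : ℕ) (v : Fin (n + 2)) : space (interval k ε i j) v →ₗ[k] k :=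
  if h : i ≤ v.val ∧ v.val < j then
    (LinearMap.proj ⟨h⟩ : (PLift (i ≤ v.val ∧ v.val < j) → k) →ₗ[k] k)
  else 0

theorem coord_apply {i j : ℕ} {v : Fin (n + 2)} (h : i ≤ v.val ∧ v.val < j)
    (x : space (interval k ε i j) v) :
    coord i j v x = (x : PLift (i ≤ v.val ∧ v.val < j) → k) ⟨h⟩ :=
  congrArg (fun f : space (interval k ε i j) v →ₗ[k] k => f x) (dif_pos h)

theorem coord_unitVec {i j : ℕ} {v : Fin (n + 2)} (h : i ≤ v.val ∧ v.val < j) :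
    coord i j v (unitVec (k := k) (ε := ε) i j v) = 1 :=
  coord_apply h _

theorem space_interval_ext {i j : ℕ} {v : Fin (n + 2)} {x y : space (interval k ε i j) v}
    (h : i ≤ v.val ∧ v.val < j → coord i j v x = coord i j v y) : x = y := by
  refine funext fun t : PLift (i ≤ v.val ∧ v.val < j) => ?_
  have := h t.down
  rw [coord_apply t.down, coord_apply t.down] at this
  exact this

theorem coord_eq_zero {i j : ℕ} {v : Fin (n + 2)} (h : ¬ (i ≤ v.val ∧ v.val < j)) :
    coord (k := k) (ε := ε) i j v = 0 := dif_neg h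

theorem eq_zero_of_notMem {i j : ℕ} {v : Fin (n + 2)} (h : ¬ (i ≤ v.val ∧ v.val < j))
    (x : space (interval k ε i j) v) : x = 0 :=
  space_interval_ext fun h' => absurd h' h

theorem coord_smul_unitVec {i j : ℕ} {v : Fin (n + 2)} (x : space (interval k ε i j) v) :
    coord i j v x • unitVec i j v = x :=
  space_interval_ext fun h => by simp [coord_unitVec h]

theorem coord_arrowMap {i j : ℕ} {a b : Fin (n + 2)} (α : Arrow ε a b)
    (h : i ≤ b.val ∧ b.val < j) (x : space (interval k ε i j) a) :
    coord i j b (arrowMap _ α x) = coord i j a x := by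
  by_cases ha : i ≤ a.val ∧ a.val < j
  · rw [coord_apply h, coord_apply ha]
    change indicatorMap k (i ≤ a.val ∧ a.val < j) _ x ⟨h⟩ = _
    simp only [indicatorMap, dif_pos ha]
    rfl
  · rw [eq_zero_of_notMem ha x]
    simp

theorem arrowMap_unitVec {i j : ℕ} {a b : Fin (n + 2)} (α : Arrow ε a b)
    (h : i ≤ a.val ∧ a.val < j) :
    arrowMap (interval k ε i j) α (unitVec i j a) = unitVec i j b :=
  space_interval_ext fun hb => by rw [coord_arrowMap α hb, coord_unitVec h, coord_unitVec hb]

/-- The edge `e` supports cocycles for `Ext¹` between the intervals `[i, j)` and `[i', j')`: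
its source lies in the first one and its target in the second one. -/
def SupportsCocycle (ε : Fin (n + 1) → Bool) (i j i' j' : ℕ) (e : Fin (n + 1)) : Prop :=
  (ε e = true ∧ (i ≤ e.val ∧ e.val < j) ∧ (i' ≤ e.val + 1 ∧ e.val + 1 < j')) ∨
    (ε e = false ∧ (i ≤ e.val + 1 ∧ e.val + 1 < j) ∧ (i' ≤ e.val ∧ e.val < j'))

/-- A coboundary is given by one scalar per vertex of the intersection, and counts as 0 off it.
Summing the cocycle along the line yields a potential, unique up to a constant. The hypothesis says
that the only outside vertex met by a supporting edge is x, so normalising the potential to vanish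
at x suffices. -/
theorem subsingleton_ext_interval {i j i' j' : ℕ} (x : ℕ)
    (h : ∀ e, SupportsCocycle ε i j i' j' e →
      (¬ ((i ≤ e.val ∧ e.val < j) ∧ (i' ≤ e.val ∧ e.val < j')) → e.val = x) ∧
      (¬ ((i ≤ e.val + 1 ∧ e.val + 1 < j) ∧ (i' ≤ e.val + 1 ∧ e.val + 1 < j')) →
        e.val + 1 = x)) :
    Subsingleton (Abelian.Ext (interval k ε i j) (interval k ε i' j') 1) := by
  refine subsingleton_ext_one_of_coboundary fun c => ?_
  -- The increment from m to m + 1; the sign changes for a left arrow, whose target is m.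
  let d : ℕ → k := fun m => if hm : m < n + 1 then
    (if hε : ε ⟨m, hm⟩ = true then
      coord i' j' _ (c (Arrow.right ⟨m, hm⟩ hε) (unitVec i j _))
    else -coord i' j' _ (c (Arrow.left ⟨m, hm⟩ (by simpa using hε)) (unitVec i j _))) else 0
  let H : ℕ → k := fun m => ∑ t ∈ Finset.range m, d t
  have hH : ∀ m, H (m + 1) = H m + d m := fun m => Finset.sum_range_succ _ _
  refine ⟨fun v => (LinearMap.toSpanSingleton k _ (unitVec i' j' v)) ∘ₗ
    ((H v.val - H x) • coord i j v), fun {a b} α => ?_⟩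
  have key : (i ≤ a.val ∧ a.val < j) → (i' ≤ b.val ∧ b.val < j') →
      coord i' j' b (c α (unitVec i j a)) = (H b.val - H x) - (H a.val - H x) ∧
      (¬ (i ≤ b.val ∧ b.val < j) → b.val = x) ∧ (¬ (i' ≤ a.val ∧ a.val < j') → a.val = x) := by
    intro ha hb
    cases α with
    | right e he =>
      have := h e (Or.inl ⟨he, ha, hb⟩)
      simp only [Fin.val_castSucc, Fin.val_succ] at ha hb ⊢
      refine ⟨?_, fun h' => this.2 fun h'' => h' h''.1, fun h' => this.1 fun h'' => h' h''.2⟩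
      have : d e.val = coord i' j' _ (c (Arrow.right e he) (unitVec i j _)) := by
        simp only [d, dif_pos e.isLt, Fin.eta, dif_pos he]
      rw [hH, this]; ring
    | left e he =>
      have := h e (Or.inr ⟨he, ha, hb⟩)
      simp only [Fin.val_castSucc, Fin.val_succ] at ha hb ⊢
      refine ⟨?_, fun h' => this.1 fun h'' => h' h''.1, fun h' => this.2 fun h'' => h' h''.2⟩
      have : d e.val = - coord i' j' _ (c (Arrow.left e he) (unitVec i j _)) := by
        simp only [d, dif_pos e.isLt, Fin.eta, he, Bool.false_eq_true, dite_false]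
      rw [hH, this]; ring
  ext y
  rw [← coord_smul_unitVec y]
  simp only [map_smul]
  congr 1
  refine space_interval_ext fun hb => ?_
  by_cases ha : i ≤ a.val ∧ a.val < j
  · obtain ⟨h₁, h₂, h₃⟩ := key ha hb
    rw [h₁]
    simp only [LinearMap.sub_apply, LinearMap.comp_apply, arrowMap_unitVec α ha,
      LinearMap.smul_apply, LinearMap.toSpanSingleton_apply, map_sub, map_smul,
      coord_arrowMap α hb, coord_unitVec ha, coord_unitVec hb, smul_eq_mul, mul_one]
    have e₁ : (H b.val - H x) * coord i j b (unitVec (k := k) (ε := ε) i j b) =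
        H b.val - H x := by
      by_cases hb' : i ≤ b.val ∧ b.val < j
      · rw [coord_unitVec hb', mul_one]
      · rw [h₂ hb', sub_self, zero_mul]
    have e₂ : (H a.val - H x) * coord i' j' a (unitVec (k := k) (ε := ε) i' j' a) =
        H a.val - H x := by
      by_cases ha' : i' ≤ a.val ∧ a.val < j'
      · rw [coord_unitVec ha', mul_one]
      · rw [h₃ ha', sub_self, zero_mul]
    rw [e₁, ← sub_mul, e₂]
  · rw [eq_zero_of_notMem ha (unitVec i j a)]
    simp

/-- A potential η for the cocycle concentrated on the edge s would vanish at s and at t, both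
outside the intersection. But between them it jumps exactly once, on the first edge. -/
theorem not_subsingleton_ext_interval {i j i' j' : ℕ} (s t : ℕ) (hst : s < t) (ht : t < n + 2)
    (h : ∀ e : Fin (n + 1), s ≤ e.val → e.val < t → SupportsCocycle ε i j i' j' e)
    (hs : ¬ ((i ≤ s ∧ s < j) ∧ (i' ≤ s ∧ s < j')))
    (ht' : ¬ ((i ≤ t ∧ t < j) ∧ (i' ≤ t ∧ t < j'))) :
    ¬ Subsingleton (Abelian.Ext (interval k ε i j) (interval k ε i' j') 1) := by
  classical
  intro hsub
  obtain ⟨φ, hφ⟩ := coboundary_of_subsingleton_ext_one (A := interval k ε i j)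
    (B := interval k ε i' j') fun {a b} _ =>
      if (a.val ≤ s ∧ b.val = s + 1) ∨ (a.val = s + 1 ∧ b.val ≤ s) then
        LinearMap.toSpanSingleton k _ (unitVec i' j' b) ∘ₗ coord i j a else 0
  let η : Fin (n + 2) → k := fun v => coord i' j' v (φ v (unitVec i j v))
  have hη : ∀ v : Fin (n + 2), ¬ ((i ≤ v.val ∧ v.val < j) ∧ (i' ≤ v.val ∧ v.val < j')) →
      η v = 0 := by
    intro v hv
    by_cases h' : i ≤ v.val ∧ v.val < j
    · simp [η, coord_eq_zero fun h'' => hv ⟨h', h''⟩]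
    · simp [η, eq_zero_of_notMem h' (unitVec i j v)]
  have key : ∀ {a b : Fin (n + 2)}, Arrow ε a b → (i ≤ a.val ∧ a.val < j) →
      (i' ≤ b.val ∧ b.val < j') →
      (if (a.val ≤ s ∧ b.val = s + 1) ∨ (a.val = s + 1 ∧ b.val ≤ s) then (1 : k) else 0) =
        η b - η a := by
    intro a b α ha hb
    have := congrArg (coord i' j' b) (LinearMap.congr_fun (hφ α) (unitVec i j a))
    simp only [LinearMap.sub_apply, LinearMap.comp_apply, arrowMap_unitVec α ha, map_sub,
      coord_arrowMap α hb] at this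
    rw [← this]
    split_ifs
    · simp [coord_unitVec ha, coord_unitVec hb]
    · simp
  have step : ∀ e : Fin (n + 1), s ≤ e.val → e.val < t →
      if e.val = s then η e.succ ≠ η e.castSucc else η e.succ = η e.castSucc := by
    intro e h₁ h₂
    rcases h e h₁ h₂ with ⟨he, ha, hb⟩ | ⟨he, ha, hb⟩
    · have := key (Arrow.right e he) (by simpa using ha) (by simpa using hb)
      simp only [Fin.val_castSucc, Fin.val_succ] at this
      split_ifs with hes
      · rw [if_pos (by omega)] at this
        intro h'; rw [h', sub_self] at this; exact one_ne_zero this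
      · rw [if_neg (by omega)] at this
        exact sub_eq_zero.1 this.symm
    · have := key (Arrow.left e he) (by simpa using ha) (by simpa using hb)
      simp only [Fin.val_castSucc, Fin.val_succ] at this
      split_ifs with hes
      · rw [if_pos (by omega)] at this
        intro h'; rw [h', sub_self] at this; exact one_ne_zero this
      · rw [if_neg (by omega)] at this
        exact (sub_eq_zero.1 this.symm).symm
  have all : ∀ m, s + 1 ≤ m → ∀ hm : m < n + 2, m ≤ t → η ⟨m, hm⟩ ≠ 0 := by
    intro m hm
    induction m, hm using Nat.le_induction with
    | base =>
      intro hm _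
      have := step ⟨s, by omega⟩ le_rfl hst
      rw [if_pos rfl] at this
      rwa [hη (Fin.castSucc ⟨s, _⟩) hs] at this
    | succ m hm ih =>
      intro hm' hmt
      have := step ⟨m, by omega⟩ (by simp; omega) (by simp; omega)
      rw [if_neg (by simp; omega)] at this
      change η (Fin.succ ⟨m, by omega⟩) ≠ 0
      rw [this]
      exact ih (by omega) (by omega)
  exact all t hst ht le_rfl (hη _ ht')

end Intervals

/-! ### Morphisms and short exact sequences between interval representations. -/

section IntervalHom

variable {k : Type u} [Field k] {n : ℕ} {ε : Fin (n + 1) → Bool}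

/-- Interval representations are bricks. -/
theorem exists_eq_smul_id_interval {i j : ℕ} (hij : i < j) (hj : j ≤ n + 2)
    (φ : interval k ε i j ⟶ interval k ε i j) : ∃ c : k, φ = c • 𝟙 _ := by
  let η : Fin (n + 2) → k := fun v => coord i j v (component φ v (unitVec i j v))
  have key : ∀ {a b : Fin (n + 2)}, Arrow ε a b → (i ≤ a.val ∧ a.val < j) →
      (i ≤ b.val ∧ b.val < j) → η b = η a := by
    intro a b α ha hb
    have := congrArg (coord i j b) (component_naturality φ α (unitVec i j a))
    rwa [arrowMap_unitVec α ha, coord_arrowMap α hb] at this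
  have all : ∀ m, i ≤ m → ∀ hm : m < n + 2, m < j → η ⟨m, hm⟩ = η ⟨i, by omega⟩ := by
    intro m hm
    induction m, hm using Nat.le_induction with
    | base => exact fun _ _ => rfl
    | succ m hm ih =>
      intro hm' hmj
      rw [← ih (by omega) (by omega)]
      cases hε : ε ⟨m, by omega⟩ with
      | true =>
        exact key (Arrow.right ⟨m, by omega⟩ hε) ⟨hm, by simp; omega⟩ ⟨by simp; omega, hmj⟩
      | false =>
        exact (key (Arrow.left ⟨m, by omega⟩ hε) ⟨by simp; omega, hmj⟩ ⟨hm, by simp; omega⟩).symm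
  refine ⟨η ⟨i, by omega⟩, hom_ext fun v x => ?_⟩
  rw [← coord_smul_unitVec x]
  refine space_interval_ext fun hv => ?_
  have := all v.val hv.1 v.isLt hv.2
  simp only [map_smul, component_smul, component_id, LinearMap.smul_apply, LinearMap.id_apply,
    coord_unitVec hv]
  rw [← this]
  simp [η]

theorem interval_ne_zero {i j : ℕ} (hij : i < j) (hj : j ≤ n + 2) :
    ¬ IsZero (interval k ε i j) := by
  intro h
  have h₁ := congrArg (fun t => coord i j ⟨i, by omega⟩ (component t ⟨i, by omega⟩
    (unitVec i j ⟨i, by omega⟩))) (h.eq_of_src (𝟙 (interval k ε i j)) 0)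
  simp [coord_unitVec (k := k) (ε := ε) (v := ⟨i, by omega⟩) ⟨le_refl i, hij⟩] at h₁

/-- The morphism of interval representations given by the identity on the intersection. -/
def intervalHom {i j i' j' : ℕ}
    (h : ∀ e, SupportsCocycle ε i j i' j' e →
      (((i ≤ e.val ∧ e.val < j) ∧ (i' ≤ e.val ∧ e.val < j')) ↔
        ((i ≤ e.val + 1 ∧ e.val + 1 < j) ∧ (i' ≤ e.val + 1 ∧ e.val + 1 < j')))) :
    interval k ε i j ⟶ interval k ε i' j' :=
  homMk (fun v => LinearMap.toSpanSingleton k _ (unitVec i' j' v) ∘ₗ coord i j v) fun {a b} α x => by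
    rw [← coord_smul_unitVec x]
    refine space_interval_ext fun hb => ?_
    by_cases ha : i ≤ a.val ∧ a.val < j
    · simp only [map_smul, LinearMap.comp_apply, arrowMap_unitVec α ha,
        LinearMap.toSpanSingleton_apply, coord_arrowMap α hb, coord_unitVec ha, coord_unitVec hb]
      have hab : (i ≤ b.val ∧ b.val < j) ↔ (i' ≤ a.val ∧ a.val < j') := by
        cases α with
        | right e he =>
          have := h e (Or.inl ⟨he, ha, hb⟩)
          simp only [Fin.val_castSucc, Fin.val_succ] at ha hb ⊢
          tauto
        | left e he =>
          have := h e (Or.inr ⟨he, ha, hb⟩)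
          simp only [Fin.val_castSucc, Fin.val_succ] at ha hb ⊢
          tauto
      by_cases hb' : i ≤ b.val ∧ b.val < j
      · rw [coord_unitVec hb', coord_unitVec (hab.1 hb')]
      · rw [coord_eq_zero hb', coord_eq_zero fun h => hb' (hab.2 h)]
        simp
    · simp [eq_zero_of_notMem ha (unitVec i j a)]

theorem component_intervalHom {i j i' j' : ℕ}
    (h : ∀ e, SupportsCocycle ε i j i' j' e →
      (((i ≤ e.val ∧ e.val < j) ∧ (i' ≤ e.val ∧ e.val < j')) ↔
        ((i ≤ e.val + 1 ∧ e.val + 1 < j) ∧ (i' ≤ e.val + 1 ∧ e.val + 1 < j'))))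
    (v : Fin (n + 2)) (x : space (interval k ε i j) v) :
    component (intervalHom h) v x = coord i j v x • unitVec i' j' v := rfl

/-- A subset of the vertices of an interval which is an interval closed under successors, and whose
complement is an interval, gives a short exact sequence. -/
theorem exists_shortExact_interval {i j i' j' a b : ℕ}
    (hd : ∀ v, (a ≤ v ∧ v < b) ↔ (i ≤ v ∧ v < j) ∨ (i' ≤ v ∧ v < j'))
    (hdisj : ∀ v, ¬ ((i ≤ v ∧ v < j) ∧ (i' ≤ v ∧ v < j')))
    (h : ∀ e, ¬ SupportsCocycle ε i' j' i j e) :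
    ∃ (f : interval k ε i' j' ⟶ interval k ε a b) (g : interval k ε a b ⟶ interval k ε i j)
      (w : f ≫ g = 0), (ShortComplex.mk f g w).ShortExact := by
  have hf : ∀ e, SupportsCocycle ε i' j' a b e →
      (((i' ≤ e.val ∧ e.val < j') ∧ (a ≤ e.val ∧ e.val < b)) ↔
        ((i' ≤ e.val + 1 ∧ e.val + 1 < j') ∧ (a ≤ e.val + 1 ∧ e.val + 1 < b))) := by
    intro e he
    rcases he with ⟨hε, p, q⟩ | ⟨hε, p, q⟩
    · have := ((hd _).1 q).resolve_left fun t => h e (Or.inl ⟨hε, p, t⟩)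
      exact ⟨fun _ => ⟨this, q⟩, fun _ => ⟨p, (hd _).2 (Or.inr p)⟩⟩
    · have := ((hd _).1 q).resolve_left fun t => h e (Or.inr ⟨hε, p, t⟩)
      exact ⟨fun _ => ⟨p, (hd _).2 (Or.inr p)⟩, fun _ => ⟨this, q⟩⟩
  have hg : ∀ e, SupportsCocycle ε a b i j e →
      (((a ≤ e.val ∧ e.val < b) ∧ (i ≤ e.val ∧ e.val < j)) ↔
        ((a ≤ e.val + 1 ∧ e.val + 1 < b) ∧ (i ≤ e.val + 1 ∧ e.val + 1 < j))) := by
    intro e he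
    rcases he with ⟨hε, p, q⟩ | ⟨hε, p, q⟩
    · have := ((hd _).1 p).resolve_right fun t => h e (Or.inl ⟨hε, t, q⟩)
      exact ⟨fun _ => ⟨(hd _).2 (Or.inl q), q⟩, fun _ => ⟨p, this⟩⟩
    · have := ((hd _).1 p).resolve_right fun t => h e (Or.inr ⟨hε, t, q⟩)
      exact ⟨fun _ => ⟨p, this⟩, fun _ => ⟨(hd _).2 (Or.inl q), q⟩⟩
  have w : intervalHom (k := k) hf ≫ intervalHom hg = 0 := hom_ext fun v x => by
    refine space_interval_ext fun hv => ?_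
    have : ¬ (i' ≤ v.val ∧ v.val < j') := fun h' => hdisj _ ⟨hv, h'⟩
    simp [eq_zero_of_notMem this x]
  refine ⟨intervalHom hf, intervalHom hg, w, shortExact_mk _ _ _ ?_ ?_ ?_⟩
  · intro v x y hxy
    refine space_interval_ext fun hv => ?_
    have := congrArg (coord a b v) hxy
    simpa [component_intervalHom, coord_unitVec ((hd v.val).2 (Or.inr hv))] using this
  · intro v x
    refine ⟨coord i j v x • unitVec a b v, space_interval_ext fun hv => ?_⟩
    simp [component_intervalHom, coord_unitVec hv, coord_unitVec ((hd v.val).2 (Or.inl hv))]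
  · intro v y hy
    refine ⟨coord a b v y • unitVec i' j' v, space_interval_ext fun hv => ?_⟩
    rw [component_intervalHom] at hy ⊢
    rcases (hd v.val).1 hv with h' | h'
    · have := congrArg (coord i j v) hy
      simp only [map_smul, coord_unitVec h', smul_eq_mul, mul_one, map_zero] at this
      simp [this]
    · simp [coord_unitVec h', coord_unitVec hv]

end IntervalHom

/-! ### Bricks are indecomposable. -/

section Bricks

variable {k : Type u} [Field k] {C : Type*} [Category* C] [Abelian C] [Linear k C]

/-- Objects whose endomorphisms are scalars are indecomposable. -/
theorem indecomposable_of_end_scalar {X : C} (h₀ : ¬ IsZero X)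
    (h : ∀ φ : X ⟶ X, ∃ c : k, φ = c • 𝟙 X) : Indecomposable X := by
  refine ⟨h₀, fun Y Z e => ?_⟩
  -- The idempotent projecting onto Y is a scalar c; it acts as 1 on Y and as 0 on Z, so one of the
  -- two summands is zero.
  obtain ⟨c, hc⟩ := h (e.hom ≫ biprod.fst ≫ biprod.inl ≫ e.inv)
  have hY : biprod.inl ≫ e.inv ≫ (e.hom ≫ biprod.fst ≫ biprod.inl ≫ e.inv) ≫ e.hom ≫ biprod.fst =
    𝟙 Y := by simp
  have hZ : biprod.inr ≫ e.inv ≫ (e.hom ≫ biprod.fst ≫ biprod.inl ≫ e.inv) ≫ e.hom ≫ biprod.snd =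
    (0 : Z ⟶ Z) := by simp
  rw [hc] at hY hZ
  by_cases h0 : c = 0
  · left
    rw [IsZero.iff_id_eq_zero, ← hY, h0]
    simp
  · right
    rw [IsZero.iff_id_eq_zero]
    have : c • 𝟙 Z = 0 := by simpa using hZ
    exact (smul_eq_zero_iff_right h0).1 this

end Bricks

/-! ### A criterion for Ext¹ to be a line with indecomposable middle term. -/

section ExtIntervals

variable {k : Type u} [Field k] {n : ℕ} {ε : Fin (n + 1) → Bool}

theorem interval_indecomposable {i j : ℕ} (hij : i < j) (hj : j ≤ n + 2) :
    Indecomposable (interval k ε i j) :=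
  indecomposable_of_end_scalar (k := k) (interval_ne_zero hij hj)
    (exists_eq_smul_id_interval hij hj)

/-- If `E` is an extension of `A` by a brick `B`, and `Ext¹(E, B) = 0 ≠ Ext¹(A, B)`, then
`Ext¹(A, B)` is generated by this extension. -/
theorem extGeneratedByIndec_of_shortExact {A B E : RepQ k ε} {f : B ⟶ E} {g : E ⟶ A}
    {w : f ≫ g = 0} (hS : (ShortComplex.mk f g w).ShortExact)
    (hB : ∀ φ : B ⟶ B, ∃ c : k, φ = c • 𝟙 B) (hE : Indecomposable E)
    [Subsingleton (Abelian.Ext E B 1)] (hA : ¬ Subsingleton (Abelian.Ext A B 1)) :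
    ExtGeneratedByIndec A B := by
  have gen : ∀ x : Abelian.Ext A B 1, ∃ c : k, c • (hS.extClass : Abelian.Ext A B 1) = x := by
    intro x
    -- Since Ext¹(E, B) = 0, the connecting map End(B) ⟶ Ext¹(A, B) is onto; B being a brick, its
    -- image is spanned by the extension class.
    obtain ⟨y, hy⟩ := Abelian.Ext.contravariant_sequence_exact₃ hS B x
      (Subsingleton.elim (α := Abelian.Ext E B 1) _ _) (add_zero 1)
    obtain ⟨φ, rfl⟩ := (Abelian.Ext.mk₀_bijective _ _).2 y
    obtain ⟨c, hc⟩ := hB φ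
    refine ⟨c, ?_⟩
    rw [← hy, Abelian.Ext.smul_eq_comp_mk₀, ← hc]
  have hspan : Submodule.span k {(hS.extClass : Abelian.Ext A B 1)} = ⊤ :=
    eq_top_iff.2 fun x _ => Submodule.mem_span_singleton.2 (gen x)
  have hne : (hS.extClass : Abelian.Ext A B 1) ≠ 0 := fun h0 => hA <| by
    refine subsingleton_of_forall_eq 0 fun x => ?_
    obtain ⟨c, rfl⟩ := gen x
    rw [h0, smul_zero]
  exact ⟨(finrank_eq_one_iff_of_nonzero _ hne).2 hspan, E, f, g, w, hS, hspan, hE⟩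

end ExtIntervals

/-! ### Combinatorial criteria for nonzero Ext¹ and for crossing. -/

section Combinatorics

variable {k : Type u} [Field k] {n : ℕ} {ε : Fin (n + 1) → Bool}

/-- The vertex `m` of the polygon lies above the horizontal line. -/
def IsUpper (ε : Fin (n + 1) → Bool) (m : ℕ) : Prop := ∃ e : Fin (n + 1), e.val + 1 = m ∧ ε e = true

theorem isUpper_succ_iff (e : Fin (n + 1)) : IsUpper ε (e.val + 1) ↔ ε e = true := by
  constructor
  · rintro ⟨e', h, h'⟩
    rwa [show e = e' from Fin.ext (by omega)]
  · exact fun h => ⟨e, rfl, h⟩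

/-- `Ext¹` from the interval `[i, j)` to the interval `[i', j')` does not vanish. -/
def HasExtension (ε : Fin (n + 1) → Bool) (i j i' j' : ℕ) : Prop :=
  (i < i' ∧ i' ≤ j ∧ j < j' ∧ IsUpper ε i' ∧ IsUpper ε j) ∨
  (i' < i ∧ i ≤ j' ∧ j' < j ∧ ¬ IsUpper ε i ∧ ¬ IsUpper ε j') ∨
  (i < i' ∧ j' < j ∧ IsUpper ε i' ∧ ¬ IsUpper ε j') ∨
  (i' < i ∧ j < j' ∧ ¬ IsUpper ε i ∧ IsUpper ε j)

/-- The potential can be obstructed at two places only, next to the left and to the right end of the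
intersection. The four alternatives of `HasExtension` are the ways in which both ends are
obstructed; then `not_subsingleton_ext_interval` applies with s = max i i' - 1 and t = min j j'.
Otherwise one vertex x serves for all constraints. -/
theorem subsingleton_ext_interval_iff {i j i' j' : ℕ} (hij : i < j) (hj : j ≤ n + 2)
    (hij' : i' < j') (hj' : j' ≤ n + 2) :
    Subsingleton (Abelian.Ext (interval k ε i j) (interval k ε i' j') 1) ↔
      ¬ HasExtension ε i j i' j' := by
  constructor
  · intro hsub hE
    have hup : ∀ (e : Fin (n + 1)) m, e.val + 1 = m → (IsUpper ε m ↔ ε e = true) := by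
      rintro e m rfl
      exact isUpper_succ_iff e
    revert hsub
    rcases hE with ⟨h₁, h₂, h₃, h₄, h₅⟩ | ⟨h₁, h₂, h₃, h₄, h₅⟩ | ⟨h₁, h₂, h₄, h₅⟩ |
      ⟨h₁, h₂, h₄, h₅⟩
    · refine not_subsingleton_ext_interval (i' - 1) j (by omega) (by omega) (fun e he he' => ?_)
        (by omega) (by omega)
      cases hε : ε e with
      | true => exact Or.inl ⟨hε, by omega, by omega⟩
      | false =>
        have a₁ : e.val + 1 ≠ i' := fun h => by simp [hup e _ h, hε] at h₄
        have a₂ : e.val + 1 ≠ j := fun h => by simp [hup e _ h, hε] at h₅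
        exact Or.inr ⟨hε, by omega, by omega⟩
    · refine not_subsingleton_ext_interval (i - 1) j' (by omega) (by omega) (fun e he he' => ?_)
        (by omega) (by omega)
      cases hε : ε e with
      | true =>
        have a₁ : e.val + 1 ≠ i := fun h => by simp [hup e _ h, hε] at h₄
        have a₂ : e.val + 1 ≠ j' := fun h => by simp [hup e _ h, hε] at h₅
        exact Or.inl ⟨hε, by omega, by omega⟩
      | false => exact Or.inr ⟨hε, by omega, by omega⟩
    · refine not_subsingleton_ext_interval (i' - 1) j' (by omega) (by omega) (fun e he he' => ?_)
        (by omega) (by omega)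
      cases hε : ε e with
      | true =>
        have a₂ : e.val + 1 ≠ j' := fun h => by simp [hup e _ h, hε] at h₅
        exact Or.inl ⟨hε, by omega, by omega⟩
      | false =>
        have a₁ : e.val + 1 ≠ i' := fun h => by simp [hup e _ h, hε] at h₄
        exact Or.inr ⟨hε, by omega, by omega⟩
    · refine not_subsingleton_ext_interval (i - 1) j (by omega) (by omega) (fun e he he' => ?_)
        (by omega) (by omega)
      cases hε : ε e with
      | true =>
        have a₁ : e.val + 1 ≠ i := fun h => by simp [hup e _ h, hε] at h₄
        exact Or.inl ⟨hε, by omega, by omega⟩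
      | false =>
        have a₂ : e.val + 1 ≠ j := fun h => by simp [hup e _ h, hε] at h₅
        exact Or.inr ⟨hε, by omega, by omega⟩
  · intro hE
    -- Each condition forces x to be a vertex just outside one end of the intersection. Two
    -- compatible conditions holding together would be an alternative of `HasExtension`, so at most
    -- one is active.
    obtain ⟨x, hx₁, hx₂, hx₃, hx₄⟩ : ∃ x,
        (IsUpper ε j ∧ i' ≤ j ∧ j < j' → x = j) ∧ (IsUpper ε i' ∧ i < i' ∧ i' ≤ j → x + 1 = i') ∧
        (¬ IsUpper ε i ∧ i' < i ∧ i ≤ j' → x + 1 = i) ∧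
        (¬ IsUpper ε j' ∧ i ≤ j' ∧ j' < j → x = j') := by
      unfold HasExtension at hE
      by_cases p₁ : IsUpper ε j ∧ i' ≤ j ∧ j < j'
      · exact ⟨j, by grind⟩
      by_cases p₂ : IsUpper ε i' ∧ i < i' ∧ i' ≤ j
      · exact ⟨i' - 1, by grind⟩
      by_cases p₃ : ¬ IsUpper ε i ∧ i' < i ∧ i ≤ j'
      · exact ⟨i - 1, by grind⟩
      · exact ⟨j', by grind⟩
    refine subsingleton_ext_interval x fun e he => ?_
    have hup : ∀ m, e.val + 1 = m → (IsUpper ε m ↔ ε e = true) := by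
      rintro m rfl
      exact isUpper_succ_iff e
    rcases he with ⟨hε, p, q⟩ | ⟨hε, p, q⟩
    · refine ⟨fun h => ?_, fun h => ?_⟩
      · have := hx₂ ⟨(hup i' (by omega)).2 hε, by omega, by omega⟩
        omega
      · have := hx₁ ⟨(hup j (by omega)).2 hε, by omega, by omega⟩
        omega
    · refine ⟨fun h => ?_, fun h => ?_⟩
      · have := hx₃ ⟨by rw [hup i (by omega)]; simp [hε], by omega, by omega⟩
        omega
      · have := hx₄ ⟨by rw [hup j' (by omega)]; simp [hε], by omega, by omega⟩
        omega

/-- The combinatorial description of crossing line segments. -/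
def CombCross (ε : Fin (n + 1) → Bool) (i j i' j' : ℕ) : Prop :=
  (i < i' ∧ i' < j ∧ j < j' ∧ (IsUpper ε i' ↔ IsUpper ε j)) ∨
  (i' < i ∧ i < j' ∧ j' < j ∧ (IsUpper ε i ↔ IsUpper ε j')) ∨
  (i < i' ∧ j' < j ∧ (IsUpper ε i' ↔ ¬ IsUpper ε j')) ∨
  (i' < i ∧ j < j' ∧ (IsUpper ε i ↔ ¬ IsUpper ε j))

theorem combCross_comm {i j i' j' : ℕ} : CombCross ε i j i' j' ↔ CombCross ε i' j' i j := by
  constructor <;> rintro (h | h | h | h)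
  exacts [Or.inr (Or.inl h), Or.inl h, Or.inr (Or.inr (Or.inr h)), Or.inr (Or.inr (Or.inl h)),
    Or.inr (Or.inl h), Or.inl h, Or.inr (Or.inr (Or.inr h)), Or.inr (Or.inr (Or.inl h))]

/-- Whether the relevant polygon vertex is upper or lower decides the direction in which the
extension exists. -/
theorem CombCross.hasExtension {i j i' j' : ℕ} (h : CombCross ε i j i' j') :
    HasExtension ε i j i' j' ∨ HasExtension ε i' j' i j := by
  rcases h with ⟨h₁, h₂, h₃, h⟩ | ⟨h₁, h₂, h₃, h⟩ | ⟨h₁, h₂, h⟩ | ⟨h₁, h₂, h⟩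
  · by_cases hu : IsUpper ε i'
    · exact Or.inl (Or.inl ⟨h₁, h₂.le, h₃, hu, h.1 hu⟩)
    · exact Or.inr (Or.inr (Or.inl ⟨h₁, h₂.le, h₃, hu, h.not.1 hu⟩))
  · by_cases hu : IsUpper ε i
    · exact Or.inr (Or.inl ⟨h₁, h₂.le, h₃, hu, h.1 hu⟩)
    · exact Or.inl (Or.inr (Or.inl ⟨h₁, h₂.le, h₃, hu, h.not.1 hu⟩))
  · by_cases hu : IsUpper ε i'
    · exact Or.inl (Or.inr (Or.inr (Or.inl ⟨h₁, h₂, hu, h.1 hu⟩)))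
    · exact Or.inr (Or.inr (Or.inr (Or.inr ⟨h₁, h₂, hu, not_not.1 (h.not.1 hu)⟩)))
  · by_cases hu : IsUpper ε i
    · exact Or.inr (Or.inr (Or.inr (Or.inl ⟨h₁, h₂, hu, h.1 hu⟩)))
    · exact Or.inl (Or.inr (Or.inr (Or.inr ⟨h₁, h₂, hu, not_not.1 (h.not.1 hu)⟩)))

theorem CombCross.exists_mem {i j i' j' : ℕ} (hij : i < j) (hij' : i' < j')
    (h : CombCross ε i j i' j') : ∃ v, (i ≤ v ∧ v < j) ∧ (i' ≤ v ∧ v < j') := by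
  refine ⟨max i i', ?_⟩
  unfold CombCross at h
  omega

/-- `HasExtension` allows more than a crossing only through its weak inequalities i' ≤ j and i ≤ j',
so here the two intervals are adjacent. Their union is an interval E, with Ext¹(E, B) = 0, and
serves as middle term. -/
theorem extGeneratedByIndec_interval {i j i' j' : ℕ} (hij : i < j) (hj : j ≤ n + 2)
    (hij' : i' < j') (hj' : j' ≤ n + 2) (h : HasExtension ε i j i' j')
    (hc : ¬ CombCross ε i j i' j') :
    ExtGeneratedByIndec (interval k ε i j) (interval k ε i' j') := by
  have hA := (subsingleton_ext_interval_iff (k := k) hij hj hij' hj').not.2 (not_not.2 h)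
  have hcase : (i' = j ∧ IsUpper ε j) ∨ (j' = i ∧ ¬ IsUpper ε i) := by
    unfold CombCross at hc
    unfold HasExtension at h
    grind
  have hsupp : ∀ e, ¬ SupportsCocycle ε i' j' i j e := by
    intro e he
    have hup : ∀ m, e.val + 1 = m → (IsUpper ε m ↔ ε e = true) := by
      rintro m rfl
      exact isUpper_succ_iff e
    rcases hcase with ⟨rfl, hu⟩ | ⟨rfl, hu⟩
    · rcases he with ⟨hε, p, q⟩ | ⟨hε, p, q⟩
      · omega
      · rw [hup _ (by omega), hε] at hu
        exact Bool.false_ne_true hu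
    · rcases he with ⟨hε, p, q⟩ | ⟨hε, p, q⟩
      · rw [hup _ (by omega)] at hu
        exact hu hε
      · omega
  obtain ⟨f, g, w, hS⟩ := exists_shortExact_interval (k := k) (a := min i i') (b := max j j')
    (by omega) (by omega) hsupp
  have := (subsingleton_ext_interval_iff (k := k) (ε := ε) (i := min i i') (j := max j j')
    (i' := i') (j' := j') (by omega) (by omega) hij' hj').2
    (by unfold HasExtension; rcases hcase with ⟨rfl, hu⟩ | ⟨rfl, hu⟩ <;> omega)
  exact extGeneratedByIndec_of_shortExact hS (exists_eq_smul_id_interval hij' hj')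
    (interval_indecomposable (by omega) (by omega)) hA

end Combinatorics

/-! ### Every nonzero representation has an interval retract. -/

section Classification

variable {k : Type u} [Field k] {n : ℕ} {ε : Fin (n + 1) → Bool}

/-- A family of vectors is compatible with the linear map on the edge `e`. -/
def Compatible (M : RepQ k ε) (x : ∀ v, space M v) (e : Fin (n + 1)) : Prop :=
  (∀ h : ε e = true, arrowMap M (Arrow.right e h) (x e.castSucc) = x e.succ) ∧
    ∀ h : ε e = false, arrowMap M (Arrow.left e h) (x e.succ) = x e.castSucc

/-- A family of linear forms is compatible with the linear map on the edge `e`. -/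
def DualCompatible (M : RepQ k ε) (φ : ∀ v, Module.Dual k (space M v)) (e : Fin (n + 1)) : Prop :=
  (∀ h : ε e = true, φ e.succ ∘ₗ arrowMap M (Arrow.right e h) = φ e.castSucc) ∧
    ∀ h : ε e = false, φ e.castSucc ∘ₗ arrowMap M (Arrow.left e h) = φ e.succ

/-- The vectors x define a map from the interval and the forms φ a map back. On the left of s
nothing interferes because M vanishes there; on the right of t, `hbd` provides what naturality
needs. -/
theorem exists_retract_interval_of_compatible {M : RepQ k ε} {s t : ℕ} (hst : s ≤ t)
    (ht : t < n + 2) (hM : ∀ v : Fin (n + 2), v.val < s → Subsingleton (space M v))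
    {x : ∀ v, space M v} {φ : ∀ v, Module.Dual k (space M v)}
    (hx : ∀ e : Fin (n + 1), s ≤ e.val → e.val < t → Compatible M x e)
    (hφ : ∀ e : Fin (n + 1), s ≤ e.val → e.val < t → DualCompatible M φ e)
    (hbd : ∀ e : Fin (n + 1), e.val = t →
      (∀ h : ε e = true, arrowMap M (Arrow.right e h) (x e.castSucc) = 0) ∧
        ∀ h : ε e = false, φ e.castSucc ∘ₗ arrowMap M (Arrow.left e h) = 0)
    (hone : φ ⟨t, ht⟩ (x ⟨t, ht⟩) = 1) :
    ∃ (f : interval k ε s (t + 1) ⟶ M) (g : M ⟶ interval k ε s (t + 1)), f ≫ g = 𝟙 _ := by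
  let f : interval k ε s (t + 1) ⟶ M :=
    homMk (fun v => LinearMap.toSpanSingleton k _ (x v) ∘ₗ coord s (t + 1) v) fun {a b} α y => by
      by_cases ha : s ≤ a.val ∧ a.val < t + 1
      · rw [← coord_smul_unitVec y]
        simp only [map_smul, LinearMap.comp_apply, arrowMap_unitVec α ha,
          LinearMap.toSpanSingleton_apply, coord_unitVec ha, one_smul]
        congr 1
        by_cases hb : s ≤ b.val ∧ b.val < t + 1
        · rw [coord_unitVec hb, one_smul]
          cases α with
          | right e he => exact ((hx e ha.1 (by simp at hb; omega)).1 he).symm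
          | left e he => exact ((hx e hb.1 (by simp at ha; omega)).2 he).symm
        · rw [coord_eq_zero hb, LinearMap.zero_apply, zero_smul]
          cases α with
          | right e he =>
            simp only [Fin.val_succ, Fin.val_castSucc] at ha hb
            exact ((hbd e (by omega)).1 he).symm
          | left e he =>
            simp only [Fin.val_succ, Fin.val_castSucc] at ha hb
            have := hM e.castSucc (by simp; omega)
            exact Subsingleton.elim _ _
      · simp [eq_zero_of_notMem ha y]
  let g : M ⟶ interval k ε s (t + 1) :=
    homMk (fun v => LinearMap.toSpanSingleton k _ (unitVec s (t + 1) v) ∘ₗ φ v) fun {a b} α y => by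
      refine space_interval_ext fun hb => ?_
      simp only [LinearMap.comp_apply, LinearMap.toSpanSingleton_apply, map_smul,
        coord_unitVec hb, coord_arrowMap α hb, smul_eq_mul, mul_one]
      by_cases ha : s ≤ a.val ∧ a.val < t + 1
      · rw [coord_unitVec ha, mul_one]
        cases α with
        | right e he =>
          exact LinearMap.congr_fun ((hφ e ha.1 (by simp at hb; omega)).1 he) y
        | left e he =>
          exact LinearMap.congr_fun ((hφ e hb.1 (by simp at ha; omega)).2 he) y
      · rw [coord_eq_zero ha, LinearMap.zero_apply, mul_zero]
        cases α with
        | right e he =>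
          simp only [Fin.val_succ, Fin.val_castSucc] at ha hb
          have := hM e.castSucc (by simp; omega)
          rw [Subsingleton.elim y 0, map_zero, map_zero]
        | left e he =>
          simp only [Fin.val_succ, Fin.val_castSucc] at ha hb
          exact LinearMap.congr_fun ((hbd e (by omega)).2 he) y
  refine ⟨f, g, ?_⟩
  -- The composite is a scalar, so it is enough to evaluate it at the vertex t.
  obtain ⟨c, hc⟩ := exists_eq_smul_id_interval (k := k) (ε := ε) (i := s) (j := t + 1)
    (by omega) (by omega) (f ≫ g)
  have hmem : s ≤ (⟨t, ht⟩ : Fin (n + 2)).val ∧ (⟨t, ht⟩ : Fin (n + 2)).val < t + 1 :=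
    ⟨hst, Nat.lt_succ_self t⟩
  have h₁ := congrArg (fun ψ : interval k ε s (t + 1) ⟶ interval k ε s (t + 1) => coord s (t + 1) ⟨t, ht⟩
    (component ψ ⟨t, ht⟩ (unitVec s (t + 1) ⟨t, ht⟩))) hc
  have h₂ : component (f ≫ g) ⟨t, ht⟩ (unitVec s (t + 1) ⟨t, ht⟩) =
      unitVec s (t + 1) ⟨t, ht⟩ := by
    change φ ⟨t, ht⟩ (coord s (t + 1) ⟨t, ht⟩ (unitVec (k := k) (ε := ε) s (t + 1) ⟨t, ht⟩) •
      x ⟨t, ht⟩) • unitVec (k := k) (ε := ε) s (t + 1) ⟨t, ht⟩ = _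
    rw [coord_unitVec hmem, one_smul, hone, one_smul]
  simp only [h₂, coord_unitVec (k := k) (ε := ε) hmem, component_smul, component_id, LinearMap.smul_apply,
    LinearMap.id_apply, map_smul, smul_eq_mul, mul_one] at h₁
  rw [hc, ← h₁, one_smul]

/-- A linear form on the source of `g` which vanishes on the preimage of `W` factors through `g`
by a linear form vanishing on `W`. -/
theorem exists_dual_comp_eq {V V' : Type*} [AddCommGroup V] [Module k V] [AddCommGroup V']
    [Module k V'] (g : V' →ₗ[k] V) (ψ : Module.Dual k V') (W : Submodule k V)
    (h : ∀ y, g y ∈ W → ψ y = 0) : ∃ χ : Module.Dual k V, χ ∘ₗ g = ψ ∧ ∀ w ∈ W, χ w = 0 := by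
  have hψ : ψ ∈ (LinearMap.ker (W.mkQ ∘ₗ g)).dualAnnihilator := by
    rw [Submodule.mem_dualAnnihilator]
    intro y hy
    exact h y (by simpa using hy)
  rw [← LinearMap.range_dualMap_eq_dualAnnihilator_ker] at hψ
  obtain ⟨χ, rfl⟩ := hψ
  exact ⟨χ ∘ₗ W.mkQ, rfl, fun w hw => by simp [(Submodule.Quotient.mk_eq_zero W).2 hw]⟩

/-- The families compatible with the edges between the vertices `s` and `t`. -/
def compatibleFamilies (M : RepQ k ε) (s t : ℕ) : Submodule k (∀ v, space M v) where
  carrier := {x | ∀ e : Fin (n + 1), s ≤ e.val → e.val < t → Compatible M x e}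
  add_mem' := fun {x y} hx hy e h₁ h₂ =>
    ⟨fun h => by simp [(hx e h₁ h₂).1 h, (hy e h₁ h₂).1 h],
      fun h => by simp [(hx e h₁ h₂).2 h, (hy e h₁ h₂).2 h]⟩
  zero_mem' := fun e _ _ => ⟨fun h => by simp, fun h => by simp⟩
  smul_mem' := fun c x hx e h₁ h₂ =>
    ⟨fun h => by simp [(hx e h₁ h₂).1 h], fun h => by simp [(hx e h₁ h₂).2 h]⟩

/-- The values at `t` of the families compatible between `s` and `t` which vanish at `s`. -/
def deadVectors (M : RepQ k ε) (s t : Fin (n + 2)) : Submodule k (space M t) :=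
  (compatibleFamilies M s t ⊓ LinearMap.ker (LinearMap.proj s)).map (LinearMap.proj t)

theorem mem_deadVectors {M : RepQ k ε} {s t : Fin (n + 2)} {y : space M t} :
    y ∈ deadVectors M s t ↔ ∃ x ∈ compatibleFamilies M s t, x s = 0 ∧ x t = y := by
  simp [deadVectors, and_assoc]

theorem update_mem_compatibleFamilies {M : RepQ k ε} {s : ℕ} {e : Fin (n + 1)}
    {x : ∀ v, space M v} (hx : x ∈ compatibleFamilies M s e.val) (y : space M e.succ)
    (h₁ : ∀ h : ε e = true, arrowMap M (Arrow.right e h) (x e.castSucc) = y)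
    (h₂ : ∀ h : ε e = false, arrowMap M (Arrow.left e h) y = x e.castSucc) :
    Function.update x e.succ y ∈ compatibleFamilies M s (e.val + 1) := by
  intro e' hs he'
  have n₁ : e'.castSucc ≠ e.succ := fun h => by
    have := congrArg Fin.val h
    simp at this; omega
  by_cases hee : e' = e
  · subst hee
    exact ⟨fun h => by simp [n₁, h₁ h], fun h => by simp [n₁, h₂ h]⟩
  · have n₂ : e'.succ ≠ e.succ := fun h => hee (Fin.succ_injective _ h)
    have : e'.val ≠ e.val := fun h => hee (Fin.ext h)
    have := hx e' hs (by omega)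
    exact ⟨fun h => by simp [n₁, n₂, this.1 h], fun h => by simp [n₁, n₂, this.2 h]⟩

theorem compatibleFamilies_anti {M : RepQ k ε} {s t t' : ℕ} (h : t ≤ t') :
    compatibleFamilies M s t' ≤ compatibleFamilies M s t :=
  fun _ hx e h₁ h₂ => hx e h₁ (by omega)

/-- A linear form killing the dead vectors extends backwards to a compatible family. -/
theorem exists_dualCompatible {M : RepQ k ε} (s t : Fin (n + 2)) (hst : s ≤ t)
    (ψ : Module.Dual k (space M t)) (hψ : ∀ y ∈ deadVectors M s t, ψ y = 0) :
    ∃ φ : ∀ v, Module.Dual k (space M v), φ t = ψ ∧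
      ∀ e : Fin (n + 1), s.val ≤ e.val → e.val < t.val → DualCompatible M φ e := by
  induction t using Fin.induction with
  | zero =>
    exact ⟨Function.update 0 0 ψ, by simp, fun e _ h => absurd h (by simp)⟩
  | succ e ih =>
    by_cases hs : s = e.succ
    · exact ⟨Function.update 0 e.succ ψ, by simp, fun e' h h' => by subst hs; omega⟩
    have hse : s ≤ e.castSucc := by
      have : s.val ≠ e.val + 1 := fun h => hs (Fin.ext h)
      have : s.val ≤ e.val + 1 := hst
      exact Fin.le_def.2 (by simp; omega)
    have hne : s ≠ e.succ := hs
    obtain ⟨ψ', h₀, h₁, h₂⟩ : ∃ ψ' : Module.Dual k (space M e.castSucc),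
        (∀ y ∈ deadVectors M s e.castSucc, ψ' y = 0) ∧
        (∀ h : ε e = true, ψ ∘ₗ arrowMap M (Arrow.right e h) = ψ') ∧
        (∀ h : ε e = false, ψ' ∘ₗ arrowMap M (Arrow.left e h) = ψ) := by
      -- Along a right arrow the form is pulled back, since dead vectors map to dead vectors. Along
      -- a left arrow it must be factored, which works because a vector mapping to a dead vector is
      -- itself dead.
      rcases Bool.eq_false_or_eq_true (ε e) with hε | hε
      · refine ⟨ψ ∘ₗ arrowMap M (Arrow.right e hε), fun y hy => ?_, fun _ => rfl,
          fun h => absurd h (by simp [hε])⟩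
        obtain ⟨x, hx, hx₀, rfl⟩ := mem_deadVectors.1 hy
        refine hψ _ (mem_deadVectors.2 ⟨Function.update x e.succ _,
          update_mem_compatibleFamilies hx (arrowMap M (Arrow.right e hε) (x e.castSucc))
            (fun _ => rfl) (fun h => absurd h (by simp [hε])), ?_, ?_⟩)
        · simp [hne, hx₀]
        · simp
      · obtain ⟨χ, hχ₁, hχ₂⟩ := exists_dual_comp_eq (arrowMap M (Arrow.left e hε)) ψ
          (deadVectors M s e.castSucc) fun y hy => by
            obtain ⟨x, hx, hx₀, hxy⟩ := mem_deadVectors.1 hy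
            refine hψ _ (mem_deadVectors.2 ⟨Function.update x e.succ y,
              update_mem_compatibleFamilies hx y
                (fun h => absurd h (by simp [hε])) (fun _ => hxy.symm), ?_, ?_⟩)
            · simp [hne, hx₀]
            · simp
        exact ⟨χ, hχ₂, fun h => absurd h (by simp [hε]), fun _ => hχ₁⟩
    obtain ⟨φ, hφ₁, hφ₂⟩ := ih hse ψ' h₀
    refine ⟨Function.update φ e.succ ψ, by simp, fun e' hs he' => ?_⟩
    have n₁ : e'.castSucc ≠ e.succ := fun h => by
      have := congrArg Fin.val h
      simp at this he'; omega
    by_cases hee : e' = e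
    · subst hee
      exact ⟨fun h => by simp [n₁, h₁ h, hφ₁], fun h => by simp [n₁, hφ₁, h₂ h]⟩
    · have n₂ : e'.succ ≠ e.succ := fun h => hee (Fin.succ_injective _ h)
      have : e'.val ≠ e.val := fun h => hee (Fin.ext h)
      have := hφ₂ e' hs (by simp at he' ⊢; omega)
      exact ⟨fun h => by simp [n₁, n₂, this.1 h], fun h => by simp [n₁, n₂, this.2 h]⟩

/-- Every nonzero representation has an interval representation as a retract. -/
theorem exists_retract_interval {M : RepQ k ε} (hM : ¬ IsZero M) :
    ∃ i j, i < j ∧ j ≤ n + 2 ∧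
      ∃ (f : interval k ε i j ⟶ M) (g : M ⟶ interval k ε i j), f ≫ g = 𝟙 _ := by
  classical
  have hnt : ∃ v, Nontrivial (space M v) := by
    by_contra! h
    refine hM ((IsZero.iff_id_eq_zero _).2 (hom_ext fun v x => ?_))
    have := h v
    exact Subsingleton.elim _ _
  obtain ⟨s, hs, hmin⟩ : ∃ s : Fin (n + 2), Nontrivial (space M s) ∧
      ∀ v : Fin (n + 2), v.val < s.val → Subsingleton (space M v) := by
    obtain ⟨s, hs, hmin⟩ := WellFounded.has_min (wellFounded_lt (α := Fin (n + 2)))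
      {v | Nontrivial (space M v)} hnt
    exact ⟨s, hs, fun v hv => not_nontrivial_iff_subsingleton.1 fun h => hmin v h hv⟩
  -- With s the first vertex where M is nonzero, the interval is extended to the last t reached by a
  -- family that cannot be replaced by one vanishing at s.
  let good : Finset (Fin (n + 2)) := Finset.univ.filter fun t =>
    s ≤ t ∧ ∃ x ∈ compatibleFamilies M s t, x t ∉ deadVectors M s t
  have hgood : good.Nonempty := by
    obtain ⟨y, hy⟩ := exists_ne (0 : space M s)
    refine ⟨s, Finset.mem_filter.2 ⟨Finset.mem_univ _, le_rfl, Function.update 0 s y,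
      fun e h₁ h₂ => absurd h₂ (by omega), fun h => ?_⟩⟩
    obtain ⟨x, -, h₁, h₂⟩ := mem_deadVectors.1 h
    exact hy (by simpa [h₁] using h₂.symm)
  obtain ⟨t, htg, hmax⟩ := good.exists_max_image id hgood
  obtain ⟨-, hst, x₀, hx₀, hx₀'⟩ := Finset.mem_filter.1 htg
  have hbad : ∀ e : Fin (n + 1), e.castSucc = t → ∀ x ∈ compatibleFamilies M s (e.val + 1),
      x e.succ ∈ deadVectors M s e.succ := by
    rintro e rfl x hx
    by_contra h
    have := hmax e.succ (Finset.mem_filter.2 ⟨Finset.mem_univ _,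
      hst.trans (Fin.castSucc_lt_succ).le, x, hx, h⟩)
    exact absurd this (not_le.2 Fin.castSucc_lt_succ)
  -- Maximality of t is used at the edge after t. If it points right, the extension of the family is
  -- dead, and subtracting a family that vanishes at s makes the arrow kill it. If it points left, W
  -- is enlarged by the image of the arrow; were x t in W, the family would extend up to a dead
  -- vector, hence would have been dead already at t.
  obtain ⟨x, hx, W, hW, hxW, hbd⟩ : ∃ x ∈ compatibleFamilies M s t, ∃ W : Submodule k (space M t),
      deadVectors M s t ≤ W ∧ x t ∉ W ∧ ∀ e : Fin (n + 1), ∀ het : e.castSucc = t,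
        (∀ h : ε e = true, arrowMap M (Arrow.right e h) (x e.castSucc) = 0) ∧
        ∀ h : ε e = false, ∀ y, het ▸ arrowMap M (Arrow.left e h) y ∈ W := by
    by_cases hlast : ∃ e : Fin (n + 1), e.castSucc = t
    · obtain ⟨e, rfl⟩ := hlast
      have hne : s ≠ e.succ := fun h => absurd hst (by rw [h]; exact not_le.2 Fin.castSucc_lt_succ)
      cases hε : ε e with
      | true =>
        obtain ⟨y, hy, hy₀, hy₁⟩ := mem_deadVectors.1 (hbad e rfl _ (update_mem_compatibleFamilies
          hx₀ (arrowMap M (Arrow.right e hε) (x₀ e.castSucc)) (fun _ => rfl)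
          (fun h => absurd h (by simp [hε]))))
        have hy' : y ∈ compatibleFamilies M s e.castSucc.val :=
          compatibleFamilies_anti (by simp) hy
        refine ⟨x₀ - y, sub_mem hx₀ hy', deadVectors M s e.castSucc, le_rfl, fun h => hx₀' ?_,
          fun e' he' => ?_⟩
        · have := add_mem h (mem_deadVectors.2 ⟨y, hy', hy₀, rfl⟩)
          simpa using this
        · obtain rfl := Fin.castSucc_injective _ he'
          refine ⟨fun h => ?_, fun h => absurd h (by simp [hε])⟩
          have h₁ := (hy e' hst (by simp)).1 h
          rw [Function.update_self] at hy₁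
          rw [Pi.sub_apply, map_sub, h₁, hy₁, sub_self]
      | false =>
        refine ⟨x₀, hx₀, deadVectors M s e.castSucc ⊔
          LinearMap.range (arrowMap M (Arrow.left e hε)), le_sup_left, fun h => ?_, fun e' he' => ?_⟩
        · obtain ⟨d, hd, _, ⟨w, rfl⟩, hdw⟩ := Submodule.mem_sup.1 h
          obtain ⟨y, hy, hy₀, rfl⟩ := mem_deadVectors.1 hd
          obtain ⟨z, hz, hz₀, hz₁⟩ := mem_deadVectors.1 (hbad e rfl _
            (update_mem_compatibleFamilies (sub_mem hx₀ hy) w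
              (fun h => absurd h (by simp [hε])) (fun _ => by
                rw [Pi.sub_apply, ← hdw, add_sub_cancel_left])))
          rw [Function.update_self] at hz₁
          have h₁ := (hz e hst (by simp)).2 hε
          refine hx₀' (mem_deadVectors.2 ⟨y + z, add_mem hy
            (compatibleFamilies_anti (by simp) hz), by simp [hy₀, hz₀], ?_⟩)
          rw [Pi.add_apply, ← h₁, hz₁, hdw]
        · obtain rfl := Fin.castSucc_injective _ he'
          exact ⟨fun h => absurd h (by simp [hε]), fun h y => Submodule.mem_sup_right ⟨y, rfl⟩⟩
    · exact ⟨x₀, hx₀, _, le_rfl, hx₀', fun e he => absurd ⟨e, he⟩ hlast⟩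
  obtain ⟨ψ, hψ₁, hψ₂⟩ : ∃ ψ : Module.Dual k (space M t), (∀ w ∈ W, ψ w = 0) ∧ ψ (x t) = 1 := by
    -- The identity form on k is factored through 1 ↦ x t; no nonzero multiple of x t lies in W.
    obtain ⟨χ, h₁, h₂⟩ := exists_dual_comp_eq (LinearMap.toSpanSingleton k _ (x t))
      (LinearMap.id : k →ₗ[k] k) W fun c hc => by
        by_contra h0
        exact hxW ((W.smul_mem_iff h0).1 hc)
    exact ⟨χ, h₂, by simpa using LinearMap.congr_fun h₁ 1⟩
  obtain ⟨φ, hφ₁, hφ₂⟩ := exists_dualCompatible s t hst ψ fun y hy => hψ₁ y (hW hy)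
  refine ⟨s, t + 1, by have : s.val ≤ t.val := hst; omega, by omega,
    exists_retract_interval_of_compatible hst t.isLt hmin hx hφ₂ (fun e he => ?_)
      (by rw [show (⟨t.val, t.isLt⟩ : Fin (n + 2)) = t from rfl, hφ₁, hψ₂])⟩
  have het : e.castSucc = t := Fin.ext he
  subst het
  obtain ⟨h₁, h₂⟩ := hbd e rfl
  exact ⟨h₁, fun h => LinearMap.ext fun y => by rw [hφ₁]; exact hψ₁ _ (h₂ h y)⟩

end Classification

/-! ### Crossing of segments read off from the positions of the vertices. -/

section Geometry

/-- The height at abscissa `x` of the line through `P` and `Q`. -/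
def lineHeight (P Q : ℝ × ℝ) (x : ℝ) : ℝ := P.2 + (Q.2 - P.2) * ((x - P.1) / (Q.1 - P.1))

theorem lineHeight_left (P Q : ℝ × ℝ) : lineHeight P Q P.1 = P.2 := by simp [lineHeight]

theorem lineHeight_right {P Q : ℝ × ℝ} (h : P.1 < Q.1) : lineHeight P Q Q.1 = Q.2 := by
  rw [lineHeight, div_self (sub_pos.2 h).ne']; ring

theorem lineHeight_mem_of_convex {C : Set (ℝ × ℝ)} (hC : Convex ℝ C) {P Q : ℝ × ℝ} (hP : P ∈ C)
    (hQ : Q ∈ C) (h : P.1 < Q.1) {x : ℝ} (h₁ : P.1 ≤ x) (h₂ : x ≤ Q.1) :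
    (x, lineHeight P Q x) ∈ C := by
  have hpos := sub_pos.2 h
  have h0 : 0 ≤ (x - P.1) / (Q.1 - P.1) := div_nonneg (sub_nonneg.2 h₁) hpos.le
  have h1 : (x - P.1) / (Q.1 - P.1) ≤ 1 := (div_le_one hpos).2 (by linarith)
  have hx : (x - P.1) / (Q.1 - P.1) * (Q.1 - P.1) = x - P.1 := div_mul_cancel₀ _ hpos.ne'
  convert hC hP hQ (sub_nonneg.2 h1) h0 (by ring) using 1
  ext
  · simp only [Prod.fst_add, Prod.smul_fst, smul_eq_mul]
    linear_combination -hx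
  · simp only [Prod.snd_add, Prod.smul_snd, smul_eq_mul, lineHeight]
    ring

theorem mem_of_convex_of_between {C : Set (ℝ × ℝ)} (hC : Convex ℝ C) {x y z w : ℝ}
    (hy : (x, y) ∈ C) (hw : (x, w) ∈ C) (h₁ : y ≤ z) (h₂ : z ≤ w) : (x, z) ∈ C := by
  rcases h₁.eq_or_lt with rfl | h₁
  · exact hy
  have hpos : 0 < w - y := by linarith
  have hz : (z - y) / (w - y) * (w - y) = z - y := div_mul_cancel₀ _ hpos.ne'
  have h0 : 0 ≤ (z - y) / (w - y) := div_nonneg (by linarith) hpos.le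
  have h1 : (z - y) / (w - y) ≤ 1 := (div_le_one hpos).2 (by linarith)
  convert hC hy hw (sub_nonneg.2 h1) h0 (by ring) using 1
  ext
  · simp only [Prod.fst_add, Prod.smul_fst, smul_eq_mul]
    ring
  · simp only [Prod.snd_add, Prod.smul_snd, smul_eq_mul]
    linear_combination -hz

theorem mem_openSegment_iff {P Q : ℝ × ℝ} (h : P.1 < Q.1) (z : ℝ × ℝ) :
    z ∈ openSegment ℝ P Q ↔ (P.1 < z.1 ∧ z.1 < Q.1) ∧ z.2 = lineHeight P Q z.1 := by
  have hpos := sub_pos.2 h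
  rw [openSegment_eq_image]
  constructor
  · rintro ⟨t, ⟨h0, h1⟩, rfl⟩
    simp only [Prod.fst_add, Prod.smul_fst, smul_eq_mul, Prod.snd_add, Prod.smul_snd, lineHeight]
    refine ⟨⟨by nlinarith, by nlinarith⟩, ?_⟩
    rw [show (1 - t) * P.1 + t * Q.1 - P.1 = t * (Q.1 - P.1) by ring,
      mul_div_assoc, div_self hpos.ne']
    ring
  · rintro ⟨⟨h₁, h₂⟩, hz⟩
    refine ⟨(z.1 - P.1) / (Q.1 - P.1), ⟨div_pos (by linarith) hpos,
      (div_lt_one hpos).2 (by linarith)⟩, ?_⟩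
    have hx : (z.1 - P.1) / (Q.1 - P.1) * (Q.1 - P.1) = z.1 - P.1 := div_mul_cancel₀ _ hpos.ne'
    ext
    · simp only [Prod.fst_add, Prod.smul_fst, smul_eq_mul]
      linear_combination hx
    · simp only [Prod.snd_add, Prod.smul_snd, smul_eq_mul, hz, lineHeight]
      ring

/-- An affine function which does not vanish identically at the ends of an interval has a zero inside
if and only if it changes sign. -/
theorem exists_affine_zero_iff {α β u w : ℝ} (huw : u < w) (h : α * u + β ≠ 0 ∨ α * w + β ≠ 0) :
    (∃ x, (u < x ∧ x < w) ∧ α * x + β = 0) ↔ (α * u + β) * (α * w + β) < 0 := by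
  constructor
  · rintro ⟨x, ⟨h₁, h₂⟩, hx⟩
    have hα : α ≠ 0 := by
      rintro rfl
      simp only [zero_mul, zero_add] at hx h
      simp [hx] at h
    have e : (α * u + β) * (α * w + β) = α ^ 2 * ((u - x) * (w - x)) := by
      have hβ : β = -(α * x) := by linarith
      rw [hβ]; ring
    rw [e]
    exact mul_neg_of_pos_of_neg (by positivity)
      (mul_neg_of_neg_of_pos (by linarith) (by linarith))
  · intro hneg
    have hα : α ≠ 0 := by
      rintro rfl
      simp only [zero_mul, zero_add] at hneg
      exact absurd hneg (not_lt.2 (mul_self_nonneg β))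
    refine ⟨-β / α, ?_, by field_simp; ring⟩
    have hx : -β / α * α = -β := div_mul_cancel₀ _ hα
    set x := -β / α
    have e : (α * u + β) * (α * w + β) = α ^ 2 * ((u - x) * (w - x)) := by
      have hβ : β = -(x * α) := by linarith
      rw [hβ]; ring
    rw [e] at hneg
    have h' : (u - x) * (w - x) < 0 := by
      by_contra h0
      exact absurd hneg (not_lt.2 (mul_nonneg (sq_nonneg α) (not_lt.1 h0)))
    rcases mul_neg_iff.1 h' with h'' | h''
    · linarith [h''.1, h''.2]
    · exact ⟨by linarith [h''.1], by linarith [h''.2]⟩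

theorem exists_lineHeight_eq_iff {P Q P' Q' : ℝ × ℝ} {u w : ℝ} (huw : u < w)
    (h : lineHeight P Q u - lineHeight P' Q' u ≠ 0 ∨ lineHeight P Q w - lineHeight P' Q' w ≠ 0) :
    (∃ x, (u < x ∧ x < w) ∧ lineHeight P Q x = lineHeight P' Q' x) ↔
      (lineHeight P Q u - lineHeight P' Q' u) * (lineHeight P Q w - lineHeight P' Q' w) < 0 := by
  obtain ⟨α, β, hαβ⟩ : ∃ α β : ℝ, ∀ x, lineHeight P Q x - lineHeight P' Q' x = α * x + β :=
    ⟨(Q.2 - P.2) / (Q.1 - P.1) - (Q'.2 - P'.2) / (Q'.1 - P'.1),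
      P.2 - (Q.2 - P.2) / (Q.1 - P.1) * P.1 - P'.2 + (Q'.2 - P'.2) / (Q'.1 - P'.1) * P'.1,
      fun x => by simp only [lineHeight]; ring⟩
  simp only [hαβ] at h
  rw [hαβ, hαβ, ← exists_affine_zero_iff huw h]
  simp only [← hαβ, sub_eq_zero]

/-- The conventions for x and y are opposite: for overlapping segments, an upper vertex makes the
height difference negative at one end of the common range and positive at the other. -/
theorem mul_neg_iff_of_sign {A B : Prop} {x y : ℝ} (hx : (A → x < 0) ∧ (¬ A → 0 < x))
    (hy : (B → 0 < y) ∧ (¬ B → y < 0)) : x * y < 0 ↔ (A ↔ B) := by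
  by_cases hA : A <;> by_cases hB : B <;> simp only [hA, hB, iff_true, iff_false, not_true]
  · exact mul_neg_of_neg_of_pos (hx.1 hA) (hy.1 hB)
  · exact not_lt.2 (mul_pos_of_neg_of_neg (hx.1 hA) (hy.2 hB)).le
  · exact not_lt.2 (mul_pos (hx.2 hA) (hy.1 hB)).le
  · exact mul_neg_of_pos_of_neg (hx.2 hA) (hy.2 hB)

theorem ne_zero_of_sign {A : Prop} {x : ℝ} (hx : (A → x < 0) ∧ (¬ A → 0 < x)) : x ≠ 0 := by
  by_cases hA : A
  exacts [(hx.1 hA).ne, (hx.2 hA).ne']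

theorem sign_not {A : Prop} {x : ℝ} (hx : (A → 0 < x) ∧ (¬ A → x < 0)) :
    (¬ A → x < 0) ∧ (¬ ¬ A → 0 < x) :=
  ⟨hx.2, fun h => hx.1 (not_not.1 h)⟩

theorem sign_not_of_neg {A : Prop} {x : ℝ} (hx : (A → x < 0) ∧ (¬ A → 0 < x)) :
    (¬ A → 0 < x) ∧ (¬ ¬ A → x < 0) :=
  ⟨hx.2, fun h => hx.1 (not_not.1 h)⟩

variable {n : ℕ} {ε : Fin (n + 1) → Bool} {p : Fin (n + 3) → ℝ × ℝ}

theorem IsPolygon.fst_lt (hp : IsPolygon ε p) {a b : Fin (n + 3)} (h : a < b) : (p a).1 < (p b).1 :=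
  hp.left_to_right h

/-- The extreme vertices are included so that the hull contains both the chord from a to c and the
horizontal base line. -/
theorem IsPolygon.notMem_convexHull (hp : IsPolygon ε p) {a b c : Fin (n + 3)} (hab : a < b)
    (hbc : b < c) : p b ∉ convexHull ℝ (p '' {a, c, 0, Fin.last (n + 2)}) := by
  intro h
  have h0 := hp.convex _ _ h
  have h1 : b ≠ 0 := fun h' => by rw [h'] at hab; exact absurd hab (Fin.not_lt_zero a)
  have h2 : b ≠ Fin.last (n + 2) := fun h' => by
    rw [h'] at hbc; exact absurd hbc (not_lt.2 (Fin.le_last c))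
  simp only [Set.mem_insert_iff, Set.mem_singleton_iff] at h0
  rcases h0 with h0 | h0 | h0 | h0
  · exact hab.ne' h0
  · exact hbc.ne h0
  · exact h1 h0
  · exact h2 h0

/-- An inner vertex lies above a chord between vertices on both sides of it if and only if it lies
above the horizontal line. -/
theorem IsPolygon.lineHeight_lt_or_gt (hp : IsPolygon ε p) {a b c : Fin (n + 3)} (hab : a < b)
    (hbc : b < c) :
    (IsUpper ε b.val → lineHeight (p a) (p c) (p b).1 < (p b).2) ∧
      (¬ IsUpper ε b.val → (p b).2 < lineHeight (p a) (p c) (p b).1) := by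
  have hnot := hp.notMem_convexHull hab hbc
  set C := convexHull ℝ (p '' {a, c, 0, Fin.last (n + 2)}) with hCdef
  have hC : Convex ℝ C := convex_convexHull ℝ _
  have hmem : ∀ v ∈ ({a, c, 0, Fin.last (n + 2)} : Set (Fin (n + 3))), p v ∈ C := fun v hv =>
    subset_convexHull ℝ _ (Set.mem_image_of_mem p hv)
  have h0b : (0 : Fin (n + 3)) < b := lt_of_le_of_lt (Fin.zero_le a) hab
  have hbl : b < Fin.last (n + 2) := lt_of_lt_of_le hbc (Fin.le_last c)
  have hq : ((p b).1, lineHeight (p a) (p c) (p b).1) ∈ C :=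
    lineHeight_mem_of_convex hC (hmem a (by simp)) (hmem c (by simp)) (hp.fst_lt (hab.trans hbc))
      (hp.fst_lt hab).le (hp.fst_lt hbc).le
  have hr : ((p b).1, (p 0).2) ∈ C := by
    have := lineHeight_mem_of_convex hC (hmem 0 (by simp)) (hmem (Fin.last (n + 2)) (by simp))
      (hp.fst_lt (h0b.trans hbl)) (hp.fst_lt h0b).le (hp.fst_lt hbl).le
    simpa [lineHeight, ← hp.horizontal] using this
  have hbv : 0 < b.val ∧ b.val < n + 2 := ⟨h0b, hbl⟩
  let e : Fin (n + 1) := ⟨b.val - 1, by omega⟩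
  have he : e.succ.castSucc = b := Fin.ext (by simp [e]; omega)
  have hup : IsUpper ε b.val ↔ ε e = true := by
    rw [← isUpper_succ_iff]
    rw [show e.val + 1 = b.val by simp [e]; omega]
  constructor
  · intro hu
    have h1 := hp.upper e (hup.1 hu)
    rw [he] at h1
    by_contra h
    -- An upper vertex not above the chord would lie on a vertical segment from the base line to the
    -- chord, hence in the hull.
    exact hnot (mem_of_convex_of_between hC hr hq h1.le (not_lt.1 h))
  · intro hu
    have h1 := hp.lower e (by simpa using hup.not.1 hu)
    rw [he] at h1
    by_contra h
    exact hnot (mem_of_convex_of_between hC hq hr (not_lt.1 h) h1.le)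

/-- Segments are graphs over intervals of abscissas, so they meet where their heights agree over the
common open range. -/
theorem cross_iff_exists (hp : IsPolygon ε p) (γ δ : LineSegment n) :
    Cross p γ δ ↔ γ ≠ δ ∧ ∃ x, ((p (max γ.i δ.i)).1 < x ∧ x < (p (min γ.j δ.j)).1) ∧
      lineHeight (p γ.i) (p γ.j) x = lineHeight (p δ.i) (p δ.j) x := by
  have hmono : Monotone fun v => (p v).1 := hp.left_to_right.monotone
  have hmax : (p (max γ.i δ.i)).1 = max (p γ.i).1 (p δ.i).1 := hmono.map_max
  have hmin : (p (min γ.j δ.j)).1 = min (p γ.j).1 (p δ.j).1 := hmono.map_min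
  rw [hmax, hmin, Cross]
  refine and_congr_right fun _ => ⟨?_, ?_⟩
  · rintro ⟨z, h₁, h₂⟩
    rw [mem_openSegment_iff (hp.fst_lt γ.lt)] at h₁
    rw [mem_openSegment_iff (hp.fst_lt δ.lt)] at h₂
    exact ⟨z.1, ⟨max_lt h₁.1.1 h₂.1.1, lt_min h₁.1.2 h₂.1.2⟩, h₁.2.symm.trans h₂.2⟩
  · rintro ⟨x, ⟨h₁, h₂⟩, h⟩
    rw [max_lt_iff] at h₁
    rw [lt_min_iff] at h₂
    exact ⟨(x, lineHeight (p γ.i) (p γ.j) x),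
      (mem_openSegment_iff (hp.fst_lt γ.lt) _).2 ⟨⟨h₁.1, h₂.1⟩, rfl⟩,
      (mem_openSegment_iff (hp.fst_lt δ.lt) _).2 ⟨⟨h₁.2, h₂.2⟩, h⟩⟩

/-- Crossing of line segments in combinatorial terms. -/
theorem cross_iff_combCross (hp : IsPolygon ε p) (γ δ : LineSegment n) :
    Cross p γ δ ↔ CombCross ε γ.i γ.j δ.i δ.j := by
  rw [cross_iff_exists hp]
  obtain ⟨i, j, hij⟩ := γ
  obtain ⟨i', j', hij'⟩ := δ
  simp only [ne_eq, LineSegment.mk.injEq]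
  by_cases hlt : max i i' < min j j'
  swap
  · have hlt' : ¬ (max i.val i'.val < min j.val j'.val) := fun h => hlt (by
      simp only [max_lt_iff, lt_min_iff, Fin.lt_def] at h ⊢; exact h)
    constructor
    · rintro ⟨-, x, ⟨h₁, h₂⟩, -⟩
      exact absurd (h₁.trans h₂) (not_lt.2 (hp.left_to_right.monotone (not_lt.1 hlt)))
    · intro h
      have h₁ : i.val < j.val := hij
      have h₂ : i'.val < j'.val := hij'
      unfold CombCross at h
      omega
  have huw := hp.fst_lt hlt
  simp only [max_lt_iff, lt_min_iff] at hlt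
  obtain ⟨⟨-, hij₂⟩, hij₁, -⟩ := hlt
  -- At each end of the common range G is 0 for a shared endpoint; otherwise its sign tells on which
  -- side of the longer-reaching segment the inner endpoint lies, that is, whether that endpoint is
  -- upper.
  set G : ℝ → ℝ := fun x => lineHeight (p i) (p j) x - lineHeight (p i') (p j') x with hG
  have hi₁ : i = i' → G (p (max i i')).1 = 0 := by
    rintro rfl
    simp [hG, lineHeight_left]
  have hi₂ : i < i' → (IsUpper ε i'.val → G (p (max i i')).1 < 0) ∧
      (¬ IsUpper ε i'.val → 0 < G (p (max i i')).1) := by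
    intro h
    have := hp.lineHeight_lt_or_gt h hij₂
    rw [max_eq_right h.le]
    simp only [hG, lineHeight_left]
    exact ⟨fun hu => by linarith [this.1 hu], fun hu => by linarith [this.2 hu]⟩
  have hi₃ : i' < i → (IsUpper ε i.val → 0 < G (p (max i i')).1) ∧
      (¬ IsUpper ε i.val → G (p (max i i')).1 < 0) := by
    intro h
    have := hp.lineHeight_lt_or_gt h hij₁
    rw [max_eq_left h.le]
    simp only [hG, lineHeight_left]
    exact ⟨fun hu => by linarith [this.1 hu], fun hu => by linarith [this.2 hu]⟩
  have hj₁ : j = j' → G (p (min j j')).1 = 0 := by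
    rintro rfl
    simp [hG, lineHeight_right (hp.fst_lt hij), lineHeight_right (hp.fst_lt hij')]
  have hj₂ : j < j' → (IsUpper ε j.val → 0 < G (p (min j j')).1) ∧
      (¬ IsUpper ε j.val → G (p (min j j')).1 < 0) := by
    intro h
    have := hp.lineHeight_lt_or_gt hij₂ h
    rw [min_eq_left h.le]
    simp only [hG, lineHeight_right (hp.fst_lt hij)]
    exact ⟨fun hu => by linarith [this.1 hu], fun hu => by linarith [this.2 hu]⟩
  have hj₃ : j' < j → (IsUpper ε j'.val → G (p (min j j')).1 < 0) ∧
      (¬ IsUpper ε j'.val → 0 < G (p (min j j')).1) := by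
    intro h
    have := hp.lineHeight_lt_or_gt hij₁ h
    rw [min_eq_right h.le]
    simp only [hG, lineHeight_right (hp.fst_lt hij')]
    exact ⟨fun hu => by linarith [this.1 hu], fun hu => by linarith [this.2 hu]⟩
  rcases lt_trichotomy i i' with hi | hi | hi <;> rcases lt_trichotomy j j' with hj | hj | hj
  · have h : ¬ (i = i' ∧ j = j') := fun h => hi.ne h.1
    rw [exists_lineHeight_eq_iff huw (Or.inl (ne_zero_of_sign (hi₂ hi))), and_iff_right h,
      mul_neg_iff_of_sign (hi₂ hi) (hj₂ hj)]
    simp [CombCross, hi, hj, hij₂, hi.not_gt, hj.not_gt]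
  · have h : ¬ (i = i' ∧ j = j') := fun h => hi.ne h.1
    rw [exists_lineHeight_eq_iff huw (Or.inl (ne_zero_of_sign (hi₂ hi))), and_iff_right h]
    change G _ * G _ < 0 ↔ _
    rw [hj₁ hj]
    simp [CombCross, hj]
  · have h : ¬ (i = i' ∧ j = j') := fun h => hi.ne h.1
    rw [exists_lineHeight_eq_iff huw (Or.inl (ne_zero_of_sign (hi₂ hi))), and_iff_right h,
      mul_neg_iff_of_sign (hi₂ hi) (sign_not_of_neg (hj₃ hj))]
    simp [CombCross, hi, hj, hi.not_gt, hj.not_gt]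
  · have h : ¬ (i = i' ∧ j = j') := fun h => hj.ne h.2
    rw [exists_lineHeight_eq_iff huw (Or.inr (ne_zero_of_sign (sign_not (hj₂ hj)))),
      and_iff_right h]
    change G _ * G _ < 0 ↔ _
    rw [hi₁ hi]
    simp [CombCross, hi]
  · simp [CombCross, hi, hj]
  · have h : ¬ (i = i' ∧ j = j') := fun h => hj.ne' h.2
    rw [exists_lineHeight_eq_iff huw (Or.inr (ne_zero_of_sign (hj₃ hj))), and_iff_right h]
    change G _ * G _ < 0 ↔ _
    rw [hi₁ hi]
    simp [CombCross, hi]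
  · have h : ¬ (i = i' ∧ j = j') := fun h => hi.ne' h.1
    rw [exists_lineHeight_eq_iff huw (Or.inl (ne_zero_of_sign (sign_not (hi₃ hi)))),
      and_iff_right h, mul_neg_iff_of_sign (sign_not (hi₃ hi)) (hj₂ hj)]
    simp only [CombCross, Fin.val_fin_lt, hi, hj, hi.not_gt, hj.not_gt, false_and, and_false,
      true_and, false_or]
    exact not_iff_comm.trans Iff.comm
  · have h : ¬ (i = i' ∧ j = j') := fun h => hi.ne' h.1
    rw [exists_lineHeight_eq_iff huw (Or.inl (ne_zero_of_sign (sign_not (hi₃ hi)))),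
      and_iff_right h]
    change G _ * G _ < 0 ↔ _
    rw [hj₁ hj]
    simp [CombCross, hj]
  · have h : ¬ (i = i' ∧ j = j') := fun h => hi.ne' h.1
    rw [exists_lineHeight_eq_iff huw (Or.inl (ne_zero_of_sign (sign_not (hi₃ hi)))),
      and_iff_right h, mul_comm, mul_neg_iff_of_sign (hj₃ hj) (hi₃ hi)]
    simp only [CombCross, Fin.val_fin_lt, hi, hj, hij₁, hi.not_gt, hj.not_gt, false_and, and_false,
      true_and, false_or, or_false]
    exact Iff.comm

end Geometry

/-! ### Retracts, direct summands and bricks. -/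

section Retracts

variable {C : Type*} [Category* C]

/-- `A` is a retract, equivalently a direct summand, of `T`. -/
def IsRetract (A T : C) : Prop := ∃ (f : A ⟶ T) (g : T ⟶ A), f ≫ g = 𝟙 A

theorem IsRetract.of_iso {A A' T T' : C} (e : A ≅ A') (e' : T ≅ T') (h : IsRetract A T) :
    IsRetract A' T' := by
  obtain ⟨f, g, h⟩ := h
  exact ⟨e.inv ≫ f ≫ e'.hom, e'.inv ≫ g ≫ e.hom, by simp [reassoc_of% h]⟩

theorem IsRetract.trans {A B T : C} (h : IsRetract A B) (h' : IsRetract B T) : IsRetract A T := by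
  obtain ⟨f, g, h⟩ := h
  obtain ⟨f', g', h'⟩ := h'
  exact ⟨f ≫ f', g' ≫ g, by simp [reassoc_of% h', h]⟩

variable [Abelian C]

theorem isRetract_biprod_left (A B : C) : IsRetract A (A ⊞ B) :=
  ⟨biprod.inl, biprod.fst, biprod.inl_fst⟩

theorem isRetract_biprod_right (A B : C) : IsRetract B (A ⊞ B) :=
  ⟨biprod.inr, biprod.snd, biprod.inr_snd⟩

theorem IsRetract.biprod {A B X Y : C} (h : IsRetract A X) (h' : IsRetract B Y) :
    IsRetract (A ⊞ B) (X ⊞ Y) := by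
  obtain ⟨f, g, h⟩ := h
  obtain ⟨f', g', h'⟩ := h'
  exact ⟨biprod.map f f', biprod.map g g', by ext <;> simp [h, h']⟩

theorem IsRetract.exists_iso_biprod {A T : C} (h : IsRetract A T) :
    ∃ Z : C, Nonempty (T ≅ A ⊞ Z) := by
  obtain ⟨f, g, h⟩ := h
  have : IsSplitMono f := ⟨⟨⟨g, h⟩⟩⟩
  have hb := isBilimitBinaryBiconeOfIsSplitMonoOfCokernel (cokernelIsCokernel f)
  exact ⟨_, ⟨biprod.uniqueUpToIso _ _ hb⟩⟩

theorem isRetract_iff {A T : C} : IsRetract A T ↔ ∃ Z : C, Nonempty (T ≅ A ⊞ Z) :=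
  ⟨IsRetract.exists_iso_biprod, fun ⟨Z, ⟨e⟩⟩ =>
    (isRetract_biprod_left A Z).of_iso (Iso.refl _) e.symm⟩

variable {k : Type u} [Field k] [Linear k C]

/-- A brick is a retract of `T` as soon as its identity factors up to a nonzero scalar. -/
theorem isRetract_of_comp_ne_zero {A T : C} (hA : ∀ φ : A ⟶ A, ∃ c : k, φ = c • 𝟙 A)
    (f : A ⟶ T) (g : T ⟶ A) (h : f ≫ g ≠ 0) : IsRetract A T := by
  obtain ⟨c, hc⟩ := hA (f ≫ g)
  have hc0 : c ≠ 0 := by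
    rintro rfl
    exact h (by rw [hc, zero_smul])
  exact ⟨c⁻¹ • f, g, by rw [Linear.smul_comp, hc, smul_smul, inv_mul_cancel₀ hc0, one_smul]⟩

/-- The identity of A is the sum of its composites through the X i. Some composite is nonzero, and
for a brick this already gives a retract. -/
theorem IsRetract.exists_of_biproduct {ι : Type} [Finite ι] {X : ι → C} [HasBiproduct X] {A : C}
    (hA : ∀ φ : A ⟶ A, ∃ c : k, φ = c • 𝟙 A) (h₀ : ¬ IsZero A) (h : IsRetract A (⨁ X)) :
    ∃ i, IsRetract A (X i) := by
  have := Fintype.ofFinite ι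
  obtain ⟨f, g, h⟩ := h
  by_contra! hX
  refine h₀ ((IsZero.iff_id_eq_zero A).2 ?_)
  rw [← h, ← Category.id_comp g, ← biproduct.total, Preadditive.sum_comp, Preadditive.comp_sum]
  refine Finset.sum_eq_zero fun i _ => ?_
  by_contra hne
  exact hX i (isRetract_of_comp_ne_zero hA (f ≫ biproduct.π X i) (biproduct.ι X i ≫ g)
    (by simpa using hne))

end Retracts

/-! ### Basic representations and sets of line segments. -/

section Summands

variable {k : Type u} [Field k] {n : ℕ} {ε : Fin (n + 1) → Bool}

theorem F_brick (γ : LineSegment n) (φ : F k ε γ ⟶ F k ε γ) : ∃ c : k, φ = c • 𝟙 _ :=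
  exists_eq_smul_id_interval γ.lt (by omega) φ

theorem F_not_isZero (γ : LineSegment n) : ¬ IsZero (F k ε γ) :=
  interval_ne_zero γ.lt (by omega)

theorem F_indecomposable (γ : LineSegment n) : Indecomposable (F k ε γ) :=
  interval_indecomposable γ.lt (by omega)

theorem exists_isRetract_F {M : RepQ k ε} (hM : ¬ IsZero M) :
    ∃ γ : LineSegment n, IsRetract (F k ε γ) M := by
  obtain ⟨i, j, hij, hj, h⟩ := exists_retract_interval hM
  exact ⟨⟨⟨i, by omega⟩, ⟨j, by omega⟩, hij⟩, h⟩

/-- The indecomposable representations are the interval representations. -/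
theorem exists_iso_F {A : RepQ k ε} (hA : Indecomposable A) :
    ∃ γ : LineSegment n, Nonempty (A ≅ F k ε γ) := by
  obtain ⟨γ, hγ⟩ := exists_isRetract_F hA.1
  obtain ⟨Z, ⟨e⟩⟩ := hγ.exists_iso_biprod
  have hZ : IsZero Z := (hA.2 _ _ e).resolve_left (F_not_isZero γ)
  refine ⟨γ, ⟨e ≪≫ ⟨biprod.fst, biprod.inl, ?_, biprod.inl_fst⟩⟩⟩
  refine biprod.hom_ext' _ _ ?_ (hZ.eq_of_src _ _)
  simp

theorem mem_of_comp_eq_smul_id {i j i' j' : ℕ} {f : interval k ε i j ⟶ interval k ε i' j'}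
    {g : interval k ε i' j' ⟶ interval k ε i j} {c : k} (hc : c ≠ 0) (h : f ≫ g = c • 𝟙 _)
    {v : Fin (n + 2)} (hv : i ≤ v.val ∧ v.val < j) : i' ≤ v.val ∧ v.val < j' := by
  by_contra hv'
  have h₁ := congrArg (fun t : interval k ε i j ⟶ interval k ε i j =>
    coord i j v (component t v (unitVec i j v))) h
  have h₂ : component f v (unitVec i j v) = 0 := eq_zero_of_notMem hv' _
  simp [h₂, coord_unitVec (k := k) (ε := ε) hv] at h₁
  exact hc h₁.symm

/-- Both composites are nonzero scalars, so the two representations have the same support, and the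
support determines the segment. -/
theorem eq_of_isRetract_F {γ δ : LineSegment n} (h : IsRetract (F k ε γ) (F k ε δ)) : γ = δ := by
  obtain ⟨f, g, h⟩ := h
  obtain ⟨c, hc⟩ := F_brick (k := k) (ε := ε) δ (g ≫ f)
  have hc0 : c ≠ 0 := by
    rintro rfl
    rw [zero_smul] at hc
    refine F_not_isZero (k := k) (ε := ε) γ ((IsZero.iff_id_eq_zero _).2 ?_)
    calc 𝟙 (F k ε γ) = (f ≫ g) ≫ f ≫ g := by rw [h, Category.id_comp]
      _ = f ≫ (g ≫ f) ≫ g := by simp only [Category.assoc]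
      _ = 0 := by rw [hc, zero_comp, comp_zero]
  have key : ∀ v : Fin (n + 2), (γ.i.val ≤ v.val ∧ v.val < γ.j.val) ↔
      (δ.i.val ≤ v.val ∧ v.val < δ.j.val) := fun v =>
    ⟨mem_of_comp_eq_smul_id one_ne_zero (h.trans (one_smul k _).symm), mem_of_comp_eq_smul_id hc0 hc⟩
  have hγ : γ.i.val < γ.j.val := γ.lt
  have hδ : δ.i.val < δ.j.val := δ.lt
  have k₁ := key ⟨γ.i.val, by omega⟩
  have k₂ := key ⟨δ.i.val, by omega⟩
  have k₃ := key ⟨γ.j.val - 1, by omega⟩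
  have k₄ := key ⟨δ.j.val - 1, by omega⟩
  simp only at k₁ k₂ k₃ k₄
  exact LineSegment.ext (Fin.ext (by omega)) (Fin.ext (by omega))

theorem isRetract_F_biproduct_iff {S : Set (LineSegment n)} {δ : LineSegment n} :
    IsRetract (F k ε δ) (⨁ fun γ : S => F k ε γ.1) ↔ δ ∈ S := by
  constructor
  · intro h
    obtain ⟨γ, hγ⟩ := h.exists_of_biproduct (F_brick δ) (F_not_isZero δ)
    rw [eq_of_isRetract_F hγ]
    exact γ.2
  · intro h
    exact ⟨biproduct.ι (fun γ : S => F k ε γ.1) ⟨δ, h⟩,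
      biproduct.π (fun γ : S => F k ε γ.1) ⟨δ, h⟩, biproduct.ι_π_self _ _⟩

theorem not_isBasic_of_isRetract {A X Y T : RepQ k ε} (hA : Indecomposable A)
    (hX : IsRetract A X) (hY : IsRetract A Y) (e : T ≅ X ⊞ Y) : ¬ IsBasic T := fun h =>
  h A hA ((hX.biprod hY).of_iso (Iso.refl _) e.symm).exists_iso_biprod

theorem isBasic_biproduct_F (S : Set (LineSegment n)) :
    IsBasic (⨁ fun γ : S => F k ε γ.1) := by
  classical
  have := Fintype.ofFinite S
  rintro A hA ⟨Z, ⟨e⟩⟩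
  obtain ⟨δ, ⟨e'⟩⟩ := exists_iso_F hA
  have hret : IsRetract (F k ε δ ⊞ F k ε δ) (⨁ fun γ : S => F k ε γ.1) :=
    (isRetract_biprod_left (A ⊞ A) Z).of_iso (biprod.mapIso e' e') e.symm
  obtain ⟨f, g, h⟩ := hret
  have hδ : δ ∈ S := isRetract_F_biproduct_iff.1
    ((isRetract_biprod_left (F k ε δ) (F k ε δ)).trans ⟨f, g, h⟩)
  -- An endomorphism of F δ through the sum only sees the δ component, as a nonzero composite
  -- through another F γ would force γ = δ.
  have key : ∀ (a : F k ε δ ⟶ ⨁ fun γ : S => F k ε γ.1) (q : (⨁ fun γ : S => F k ε γ.1) ⟶ F k ε δ),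
      a ≫ q = (a ≫
        biproduct.π (fun γ : S => F k ε γ.1) ⟨δ, hδ⟩) ≫ biproduct.ι (fun γ : S => F k ε γ.1) ⟨δ, hδ⟩ ≫ q := by
    intro a q
    conv_lhs => rw [← Category.id_comp q, ← biproduct.total]
    rw [Preadditive.sum_comp, Preadditive.comp_sum, Finset.sum_eq_single ⟨δ, hδ⟩]
    · simp
    · intro γ _ hγ
      by_contra hne
      exact hγ (Subtype.ext (eq_of_isRetract_F (isRetract_of_comp_ne_zero (F_brick δ)
        (a ≫ biproduct.π (fun γ : S => F k ε γ.1) γ) (biproduct.ι (fun γ : S => F k ε γ.1) γ ≫ q)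
        (by simpa using hne))).symm)
    · simp
  obtain ⟨u, hu⟩ := F_brick (k := k) (ε := ε) δ ((biprod.inl ≫ f) ≫ biproduct.π (fun γ : S => F k ε γ.1) ⟨δ, hδ⟩)
  obtain ⟨u', hu'⟩ := F_brick (k := k) (ε := ε) δ ((biprod.inr ≫ f) ≫ biproduct.π (fun γ : S => F k ε γ.1) ⟨δ, hδ⟩)
  obtain ⟨v, hv⟩ := F_brick (k := k) (ε := ε) δ
    (biproduct.ι (fun γ : S => F k ε γ.1) ⟨δ, hδ⟩ ≫ g ≫ biprod.fst)
  obtain ⟨v', hv'⟩ := F_brick (k := k) (ε := ε) δ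
    (biproduct.ι (fun γ : S => F k ε γ.1) ⟨δ, hδ⟩ ≫ g ≫ biprod.snd)
  have h₁ := key (biprod.inl ≫ f) (g ≫ biprod.fst)
  have h₂ := key (biprod.inr ≫ f) (g ≫ biprod.snd)
  have h₃ := key (biprod.inl ≫ f) (g ≫ biprod.snd)
  rw [hu, hv] at h₁
  rw [hu', hv'] at h₂
  rw [hu, hv'] at h₃
  simp only [Category.assoc, reassoc_of% h, biprod.inl_fst, biprod.inr_snd, biprod.inl_snd,
    Linear.comp_smul, Category.comp_id, smul_smul] at h₁ h₂ h₃
  have hne : 𝟙 (F k ε δ) ≠ 0 := fun h => F_not_isZero δ ((IsZero.iff_id_eq_zero _).2 h)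
  have hu0 : u ≠ 0 := by
    rintro rfl
    exact hne (by simpa using h₁)
  have hv0 : v' ≠ 0 := by
    rintro rfl
    exact hne (by simpa using h₂)
  -- Two copies of F δ would have to split off one line: the scalars satisfy u v = 1, u' v' = 1 and
  -- u v' = 0.
  exact hne ((smul_eq_zero.1 h₃.symm).resolve_left (by simp [hu0, hv0]))

/-- Adding a line segment to a set adds a summand. -/
theorem nonempty_iso_biproduct_insert {S : Set (LineSegment n)} {δ : LineSegment n} (hδ : δ ∉ S) :
    Nonempty ((⨁ fun γ : S => F k ε γ.1) ⊞ F k ε δ ≅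
      ⨁ fun γ : ↥(insert δ S : Set (LineSegment n)) => F k ε γ.1) := by
  classical
  let X : ↥(insert δ S : Set (LineSegment n)) → RepQ k ε := fun γ => F k ε γ.1
  let Y : S → RepQ k ε := fun γ => F k ε γ.1
  change Nonempty ((⨁ Y) ⊞ F k ε δ ≅ ⨁ X)
  let inc : ∀ γ : ↥(insert δ S : Set (LineSegment n)), X γ ⟶ (⨁ Y) ⊞ F k ε δ := fun γ =>
    if h : γ.1 = δ then eqToHom (by simp only [X, h]) ≫ biprod.inr
    else biproduct.ι Y ⟨γ.1, γ.2.resolve_left h⟩ ≫ biprod.inl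
  have inc₁ : inc ⟨δ, Set.mem_insert _ _⟩ = biprod.inr := by simp [inc, X]
  have inc₂ : ∀ γ : S, inc ⟨γ.1, Set.mem_insert_of_mem _ γ.2⟩ =
      biproduct.ι Y γ ≫ biprod.inl := fun γ => by
    have : γ.1 ≠ δ := fun h => hδ (h ▸ γ.2)
    simp [inc, this]
  refine ⟨⟨biprod.desc (biproduct.desc fun γ : S =>
      biproduct.ι X ⟨γ.1, Set.mem_insert_of_mem _ γ.2⟩) (biproduct.ι X ⟨δ, Set.mem_insert _ _⟩),
    biproduct.desc inc, ?_, ?_⟩⟩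
  · apply biprod.hom_ext'
    · apply biproduct.hom_ext'
      intro γ
      simp [inc₂]
    · simp [inc₁]
      rfl
  · apply biproduct.hom_ext'
    rintro ⟨γ, rfl | hγ⟩
    · simp [inc₁]
    · have := inc₂ ⟨γ, hγ⟩
      simp only [biproduct.ι_desc_assoc, Category.comp_id]
      erw [this]
      simp

end Summands

section ExtTransport

universe w

variable {C : Type*} [Category* C] [Abelian C] [HasExt.{w} C] {k : Type*} [Field k] [Linear k C]

/-- Isomorphic objects have isomorphic extension spaces. -/
def extCongr {A A' B B' : C} (e : A ≅ A') (e' : B ≅ B') :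
    Abelian.Ext A B 1 ≃ₗ[k] Abelian.Ext A' B' 1 where
  toFun x := (Abelian.Ext.mk₀ e.inv).comp (x.comp (Abelian.Ext.mk₀ e'.hom) (add_zero 1)) (zero_add 1)
  invFun x :=
    (Abelian.Ext.mk₀ e.hom).comp (x.comp (Abelian.Ext.mk₀ e'.inv) (add_zero 1)) (zero_add 1)
  map_add' x y := by simp
  map_smul' c x := by simp
  left_inv x := by simp
  right_inv x := by simp

end ExtTransport

/-! ### Almost rigid means noncrossing; maximality on both sides. -/

section MaximalAlmostRigid

variable {k : Type u} [Field k] {n : ℕ} {ε : Fin (n + 1) → Bool}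

theorem ExtGeneratedByIndec.of_iso {A A' B B' : RepQ k ε} (e : A ≅ A') (e' : B ≅ B')
    (h : ExtGeneratedByIndec A B) : ExtGeneratedByIndec A' B' := by
  obtain ⟨hd, E, f, g, w, hS, hspan, hE⟩ := h
  have w' : (e'.inv ≫ f) ≫ g ≫ e.hom = 0 := by simp [reassoc_of% w]
  let i : ShortComplex.mk f g w ≅ ShortComplex.mk (e'.inv ≫ f) (g ≫ e.hom) w' :=
    ShortComplex.isoMk e' (Iso.refl _) e (by simp) (by simp)
  have hS' := ShortComplex.shortExact_of_iso i hS
  have hcl : extCongr (k := k) e e' hS.extClass = hS'.extClass := by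
    have h : hS.extClass.comp (Abelian.Ext.mk₀ e'.hom) (add_zero 1) =
        (Abelian.Ext.mk₀ e.hom).comp hS'.extClass (zero_add 1) :=
      ShortComplex.ShortExact.extClass_naturality hS hS' i.hom
    refine (congrArg (fun x => (Abelian.Ext.mk₀ e.inv).comp x (zero_add 1)) h).trans ?_
    rw [Abelian.Ext.mk₀_comp_mk₀_assoc, e.inv_hom_id, Abelian.Ext.mk₀_id_comp]
  refine ⟨(extCongr (k := k) e e').finrank_eq.symm.trans hd, E, _, _, w', hS', ?_, hE⟩
  rw [← hcl, ← Set.image_singleton, ← LinearEquiv.coe_coe, ← Submodule.map_span, hspan,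
    Submodule.map_top, LinearEquiv.range]

theorem IsBasic.of_iso {T T' : RepQ k ε} (e : T ≅ T') (h : IsBasic T) : IsBasic T' :=
  fun A hA ⟨Z, ⟨e'⟩⟩ => h A hA ⟨Z, ⟨e ≪≫ e'⟩⟩

theorem IsAlmostRigid.of_iso {T T' : RepQ k ε} (e : T ≅ T') (h : IsAlmostRigid T) :
    IsAlmostRigid T' :=
  ⟨h.1.of_iso e, fun A B ⟨hA, Z, ⟨eA⟩⟩ ⟨hB, Z', ⟨eB⟩⟩ =>
    h.2 A B ⟨hA, Z, ⟨e ≪≫ eA⟩⟩ ⟨hB, Z', ⟨e ≪≫ eB⟩⟩⟩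

theorem IsMaximalAlmostRigid.of_iso {T T' : RepQ k ε} (e : T ≅ T') (h : IsMaximalAlmostRigid T) :
    IsMaximalAlmostRigid T' :=
  ⟨h.1.of_iso e, fun M hM h' => h.2 M hM (h'.of_iso (biprod.mapIso e.symm (Iso.refl M)))⟩

theorem ext_interval_of_not_combCross {γ δ : LineSegment n} (h : ¬ CombCross ε γ.i γ.j δ.i δ.j) :
    Subsingleton (Abelian.Ext (F k ε γ) (F k ε δ) 1) ∨
      ExtGeneratedByIndec (F k ε γ) (F k ε δ) := by
  by_cases hext : HasExtension ε γ.i γ.j δ.i δ.j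
  · exact Or.inr (extGeneratedByIndec_interval γ.lt (by omega) δ.lt (by omega) hext h)
  · exact Or.inl ((subsingleton_ext_interval_iff γ.lt (by omega) δ.lt (by omega)).2 hext)

/-- Interval representations have multiplicity at most one at every vertex. -/
theorem comp_ne_zero_of_mem {i j i' j' a b : ℕ} (f : interval k ε i' j' ⟶ interval k ε a b)
    (g : interval k ε a b ⟶ interval k ε i j) [Mono f] [Epi g] {v : Fin (n + 2)}
    (hv : i ≤ v.val ∧ v.val < j) (hv' : i' ≤ v.val ∧ v.val < j') : f ≫ g ≠ 0 := by
  intro w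
  obtain ⟨y, hy⟩ := component_surjective_of_epi g v (unitVec i j v)
  obtain ⟨x, hx⟩ : ∃ x, x = component f v (unitVec i' j' v) := ⟨_, rfl⟩
  have hgx : component g v x = 0 := by
    rw [hx]
    exact component_comp_apply_eq_zero w v _
  have hx0 : x ≠ 0 := by
    intro h0
    have h1 : unitVec (k := k) (ε := ε) i' j' v = 0 :=
      component_injective_of_mono f v (by rw [map_zero, ← hx, h0])
    have h2 := coord_unitVec (k := k) (ε := ε) hv'
    rw [h1, map_zero] at h2
    exact zero_ne_one h2
  have hc : coord a b v x ≠ 0 := fun h => hx0 (by rw [← coord_smul_unitVec x, h, zero_smul])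
  -- At v the middle space has dimension at most one, so x and y are proportional; but g kills x and
  -- not y.
  have hxy : coord a b v x • y = coord a b v y • x := by
    conv_lhs => rw [← coord_smul_unitVec y]
    conv_rhs => rw [← coord_smul_unitVec x]
    rw [smul_smul, smul_smul, mul_comm]
  have h2 := congrArg (fun z => coord i j v (component g v z)) hxy
  simp only [map_smul, hgx, hy, smul_eq_mul, map_zero, mul_zero,
    coord_unitVec (k := k) (ε := ε) hv, mul_one] at h2
  exact hc h2

/-- If the supports of `A` and `B` meet, no extension of `A` by `B` is indecomposable. -/
theorem not_extGeneratedByIndec_of_mem {γ δ : LineSegment n} {v : Fin (n + 2)}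
    (hγ : γ.i.val ≤ v.val ∧ v.val < γ.j.val) (hδ : δ.i.val ≤ v.val ∧ v.val < δ.j.val) :
    ¬ ExtGeneratedByIndec (F k ε γ) (F k ε δ) := by
  rintro ⟨-, E, f, g, w, hS, -, hE⟩
  obtain ⟨η, ⟨e⟩⟩ := exists_iso_F hE
  have : Mono f := hS.mono_f
  have : Epi g := hS.epi_g
  have w' : (f ≫ e.hom) ≫ e.inv ≫ g = 0 := by simp [w]
  have hf : Mono (f ≫ e.hom) := inferInstance
  have hg : Epi (e.inv ≫ g) := inferInstance
  exact @comp_ne_zero_of_mem k _ n ε _ _ _ _ _ _ (f ≫ e.hom) (e.inv ≫ g) hf hg v hγ hδ w'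

/-- Crossing segments have supports with a common vertex, which rules out indecomposable middle
terms. Both Ext¹ would then vanish, against `CombCross.hasExtension`. -/
theorem not_combCross_of_ext {γ δ : LineSegment n}
    (h : Subsingleton (Abelian.Ext (F k ε γ) (F k ε δ) 1) ∨
      ExtGeneratedByIndec (F k ε γ) (F k ε δ))
    (h' : Subsingleton (Abelian.Ext (F k ε δ) (F k ε γ) 1) ∨
      ExtGeneratedByIndec (F k ε δ) (F k ε γ)) :
    ¬ CombCross ε γ.i γ.j δ.i δ.j := by
  intro hc
  obtain ⟨v, hγ, hδ⟩ := hc.exists_mem γ.lt δ.lt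
  have hv : v < n + 2 := by omega
  have hs := h.resolve_right (not_extGeneratedByIndec_of_mem (v := ⟨v, hv⟩) hγ hδ)
  have hs' := h'.resolve_right (not_extGeneratedByIndec_of_mem (v := ⟨v, hv⟩) hδ hγ)
  rcases hc.hasExtension with h₁ | h₁
  · exact (subsingleton_ext_interval_iff γ.lt (by omega) δ.lt (by omega)).1 hs h₁
  · exact (subsingleton_ext_interval_iff δ.lt (by omega) γ.lt (by omega)).1 hs' h₁

theorem isIndecSummand_F_of_isRetract {γ : LineSegment n} {T : RepQ k ε}
    (h : IsRetract (F k ε γ) T) : IsIndecSummand (F k ε γ) T :=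
  ⟨F_indecomposable γ, h.exists_iso_biprod⟩

theorem IsAlmostRigid.not_combCross {T : RepQ k ε} (h : IsAlmostRigid T) {γ δ : LineSegment n}
    (hγ : IsRetract (F k ε γ) T) (hδ : IsRetract (F k ε δ) T) :
    ¬ CombCross ε γ.i γ.j δ.i δ.j :=
  not_combCross_of_ext
    (h.2 _ _ (isIndecSummand_F_of_isRetract hγ) (isIndecSummand_F_of_isRetract hδ))
    (h.2 _ _ (isIndecSummand_F_of_isRetract hδ) (isIndecSummand_F_of_isRetract hγ))

theorem isAlmostRigid_biproduct_F_iff {S : Set (LineSegment n)} :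
    IsAlmostRigid (⨁ fun γ : S => F k ε γ.1) ↔
      ∀ γ ∈ S, ∀ δ ∈ S, ¬ CombCross ε γ.i γ.j δ.i δ.j := by
  refine ⟨fun h γ hγ δ hδ => h.not_combCross (isRetract_F_biproduct_iff.2 hγ)
    (isRetract_F_biproduct_iff.2 hδ), fun h => ⟨isBasic_biproduct_F S, ?_⟩⟩
  rintro A B ⟨hA, hAS⟩ ⟨hB, hBS⟩
  obtain ⟨γ, ⟨eA⟩⟩ := exists_iso_F hA
  obtain ⟨δ, ⟨eB⟩⟩ := exists_iso_F hB
  have hγ : γ ∈ S := isRetract_F_biproduct_iff.1 ((isRetract_iff.2 hAS).of_iso eA (Iso.refl _))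
  have hδ : δ ∈ S := isRetract_F_biproduct_iff.1 ((isRetract_iff.2 hBS).of_iso eB (Iso.refl _))
  rcases ext_interval_of_not_combCross (k := k) (h γ hγ δ hδ) with hs | hg
  · exact Or.inl (extCongr (k := k) eA eB).toEquiv.subsingleton
  · exact Or.inr (hg.of_iso eA.symm eB.symm)

/-- It suffices to test maximality with intervals: an added nonzero M has some F δ as retract. If δ
is in S, basicness fails; if not, S together with δ is a larger noncrossing set. -/
theorem isMaximalAlmostRigid_biproduct_F_iff {p : Fin (n + 3) → ℝ × ℝ} (hp : IsPolygon ε p)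
    {S : Set (LineSegment n)} :
    IsMaximalAlmostRigid (⨁ fun γ : S => F k ε γ.1) ↔ IsTriangulation p S := by
  have hiff : ∀ S : Set (LineSegment n), IsAlmostRigid (⨁ fun γ : S => F k ε γ.1) ↔
      ∀ γ ∈ S, ∀ δ ∈ S, ¬ Cross p γ δ := fun S => by
    simp only [cross_iff_combCross hp, isAlmostRigid_biproduct_F_iff]
  constructor
  · intro h
    refine ⟨(hiff S).1 h.1, fun S' hS' hle δ hδ => ?_⟩
    by_contra hδS
    obtain ⟨e⟩ := nonempty_iso_biproduct_insert (k := k) (ε := ε) hδS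
    refine h.2 (F k ε δ) (F_not_isZero δ) (IsAlmostRigid.of_iso e.symm ((hiff _).2 ?_))
    have hsub : insert δ S ⊆ S' := Set.insert_subset hδ hle
    exact fun γ hγ δ' hδ' => hS' γ (hsub hγ) δ' (hsub hδ')
  · intro h
    refine ⟨(hiff S).2 h.1, fun M hM hr => ?_⟩
    obtain ⟨δ, hδ⟩ := exists_isRetract_F hM
    by_cases hδS : δ ∈ S
    · exact not_isBasic_of_isRetract (F_indecomposable δ)
        (isRetract_F_biproduct_iff.2 hδS) hδ (Iso.refl _) hr.1
    · have hret : ∀ γ ∈ insert δ S,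
          IsRetract (F k ε γ) ((⨁ fun γ : S => F k ε γ.1) ⊞ M) := by
        rintro γ (rfl | hγ)
        · exact hδ.trans (isRetract_biprod_right _ _)
        · exact (isRetract_F_biproduct_iff.2 hγ).trans (isRetract_biprod_left _ _)
      refine hδS (h.2 (y := insert δ S) (fun γ hγ η hη => ?_) (Set.subset_insert _ _)
        (Set.mem_insert _ _))
      rw [cross_iff_combCross hp]
      exact hr.not_combCross (hret γ hγ) (hret η hη)

/-- A basic representation is the direct sum of a set of interval representations. -/
theorem IsBasic.exists_iso_biproduct_F {M : RepQ k ε} (hM : IsBasic M) :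
    ∃ S : Set (LineSegment n), Nonempty (M ≅ ⨁ fun γ : S => F k ε γ.1) := by
  let P : Set (Set (LineSegment n)) :=
    {S | ∃ Z : RepQ k ε, Nonempty (M ≅ (⨁ fun γ : S => F k ε γ.1) ⊞ Z)}
  have hzero : IsZero (⨁ fun γ : (∅ : Set (LineSegment n)) => F k ε γ.1) := by
    rw [IsZero.iff_id_eq_zero]
    exact biproduct.hom_ext' _ _ fun γ => γ.2.elim
  have hP : P.Nonempty := ⟨∅, M, ⟨⟨biprod.inr, biprod.snd, biprod.inr_snd,
    biprod.hom_ext' _ _ (hzero.eq_of_src _ _) (by simp)⟩⟩⟩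
  -- There are finitely many segments, so a largest set splitting off M exists. An interval retract
  -- of a nonzero complement Z would enlarge S or repeat a summand.
  obtain ⟨S, ⟨Z, ⟨e⟩⟩, hmax⟩ := P.toFinite.exists_maximal hP
  have hZ : IsZero Z := by
    by_contra hZ
    obtain ⟨δ, hδ⟩ := exists_isRetract_F hZ
    by_cases hδS : δ ∈ S
    · exact not_isBasic_of_isRetract (F_indecomposable δ)
        (isRetract_F_biproduct_iff.2 hδS) hδ e hM
    · obtain ⟨Z', ⟨e'⟩⟩ := hδ.exists_iso_biprod
      obtain ⟨i⟩ := nonempty_iso_biproduct_insert (k := k) (ε := ε) hδS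
      exact hδS (hmax (y := insert δ S) ⟨Z', ⟨e ≪≫ biprod.mapIso (Iso.refl _) e' ≪≫
        (biprod.associator _ _ _).symm ≪≫ biprod.mapIso i (Iso.refl _)⟩⟩ (Set.subset_insert _ _)
        (Set.mem_insert _ _))
  refine ⟨S, ⟨e ≪≫ ⟨biprod.fst, biprod.inl, ?_, biprod.inl_fst⟩⟩⟩
  exact biprod.hom_ext' _ _ (by simp) (hZ.eq_of_src _ _)

theorem nonempty_iso_biproduct_pair {γ δ : LineSegment n} (h : γ ≠ δ) :
    Nonempty (F k ε γ ⊞ F k ε δ ≅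
      ⨁ fun η : ↥({δ, γ} : Set (LineSegment n)) => F k ε η.1) := by
  obtain ⟨i⟩ := nonempty_iso_biproduct_insert (k := k) (ε := ε) (S := {γ}) (δ := δ)
    (fun h' => h (Set.mem_singleton_iff.1 h').symm)
  let j : (⨁ fun η : ({γ} : Set (LineSegment n)) => F k ε η.1) ≅ F k ε γ :=
    biproductUniqueIso _
  exact ⟨biprod.mapIso j.symm (Iso.refl _) ≪≫ i⟩

end MaximalAlmostRigid

end AlmostRigid

end

/-! ### The main theorem. -/

open AlmostRigid

theorem theorem2 (k : Type u) [Field k] [IsAlgClosed k] (n : ℕ) (ε : Fin (n + 1) → Bool)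
    (p : Fin (n + 3) → ℝ × ℝ) (hp : AlmostRigid.IsPolygon ε p) :
    Set.BijOn (AlmostRigid.FSet k ε) {T | AlmostRigid.IsTriangulation p T}
        (AlmostRigid.mar k ε) ∧
      ∀ γ δ : AlmostRigid.LineSegment n, γ ≠ δ →
        (AlmostRigid.IsAlmostRigid (AlmostRigid.F k ε γ ⊞ AlmostRigid.F k ε δ) ↔
          ¬ AlmostRigid.Cross p γ δ) := by
  refine ⟨⟨?_, ?_, ?_⟩, ?_⟩
  · intro S hS
    exact ⟨_, (isMaximalAlmostRigid_biproduct_F_iff hp).2 hS, rfl⟩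
  · intro S _ S' _ h
    obtain ⟨e⟩ : Nonempty ((⨁ fun γ : S => F k ε γ.1) ≅ ⨁ fun γ : S' => F k ε γ.1) :=
      Quotient.exact h
    ext δ
    -- The set is recovered from the representation as the set of δ for which F δ is a retract.
    rw [← isRetract_F_biproduct_iff (k := k) (ε := ε) (S := S),
      ← isRetract_F_biproduct_iff (k := k) (ε := ε) (S := S')]
    exact ⟨.of_iso (Iso.refl _) e, .of_iso (Iso.refl _) e.symm⟩
  · rintro _ ⟨M, hM, rfl⟩
    obtain ⟨S, ⟨e⟩⟩ := hM.1.1.exists_iso_biproduct_F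
    exact ⟨S, (isMaximalAlmostRigid_biproduct_F_iff hp).1 (hM.of_iso e),
      Quotient.sound ⟨e.symm⟩⟩
  · intro γ δ hne
    obtain ⟨e⟩ := nonempty_iso_biproduct_pair (k := k) (ε := ε) hne
    rw [cross_iff_combCross hp]
    refine ⟨fun h => h.not_combCross (isRetract_biprod_left _ _) (isRetract_biprod_right _ _),
      fun h => IsAlmostRigid.of_iso e.symm (isAlmostRigid_biproduct_F_iff.2 ?_)⟩
    -- Almost rigidity also concerns self-extensions, so the diagonal pairs need checking;
    -- distinctness is built into `Cross`.
    have hself : ∀ η : LineSegment n, ¬ CombCross ε η.i η.j η.i η.j := fun η hη =>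
      ((cross_iff_combCross hp η η).2 hη).1 rfl
    rintro η (rfl | rfl) η' (rfl | rfl)
    · exact hself _
    · rwa [combCross_comm]
    · exact h
    · exact hself _
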